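/- Let $U\subset\mathbb{R}^2$ be open and let $f:U\to\mathbb{R}^2$ be continuous, such that for every $y_0\in U$ the initial value problem $\dot y=f(y)$, $y(0)=y_0$ has a unique solution $t\mapsto\Phi(t,y_0)\in U$ defined for all $t\in\mathbb{R}$. Let $R\subset U$ be compact and positively invariant (that is, $\Phi(t,y)\in R$ for all $y\in R$ and $t\ge 0$), let $y_0\in R$, and let $L$ be the $\omega$-limit set of $y_0$, i.e. the set of all limits $\lim_k\Phi(t_k,y_0)$ along sequences $t_k\to+\infty$. An equilibrium is a point $e \in U$ with $f(e)=0$. A periodic orbit is the orbit of a point that is not an equilibrium and whose trajectory is periodic. (A) At least one of the following holds: (1) $L$ is nonempty and consists of equilibria; (2) $L$ is a periodic orbit; (3) $L$ contains an equilibrium and a point that is not an equilibrium, and for every non-equilibrium point $y\in L$ both the $\alpha$-limit set of $y$ (the set of limits of $\Phi(t_k,y)$ along sequences $t_k\to-\infty$) and the $\omega$-limit set of $y$ are nonempty compact connected sets of equilibria. (B) Suppose that the set of equilibria in $L$ is totally disconnected (for example, that $R$ contains only finitely many equilibria). Then at least one of the following holds: (1) $L$ is a single equilibrium point; (2) $L$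 is a periodic orbit; (3) $L$ contains an equilibrium and a point that is not an equilibrium, and every non-equilibrium point of $L$ lies on a heteroclinic or homoclinic orbit, i.e. its trajectory converges to an equilibrium $a$ as $t\to-\infty$ and to an equilibrium $b$ as $t\to+\infty$ (heteroclinic if $a\neq b$, homoclinic if $a=b$). -/

import Mathlib

open Filter Topology

section PlanarFlows

variable {E : Type*} [NormedAddCommGroup E] [NormedSpace ℝ E]

/-- `γ : ℝ → E` is a solution, defined for all times and with values in `U`, of the autonomous
equation `y' = f y`. Only the values of `f` on `U` matter. -/
def IsGlobalSolution (U : Set E) (f : E → E) (γ : ℝ → E) : Prop :=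
  (∀ t, γ t ∈ U) ∧ ∀ t, HasDerivAt γ (f (γ t)) t

/-- For every `y₀ ∈ U`, the map `t ↦ Φ t y₀` is the unique solution in `U`, defined for all
`t : ℝ`, of the initial value problem `y' = f y`, `y 0 = y₀`. -/
def IsUniqueSolutionMap (U : Set E) (f : E → E) (Φ : ℝ → E → E) : Prop :=
  ∀ y₀ ∈ U, (IsGlobalSolution U f (fun t => Φ t y₀) ∧ Φ 0 y₀ = y₀) ∧
    ∀ γ : ℝ → E, IsGlobalSolution U f γ → γ 0 = y₀ → γ = fun t => Φ t y₀

/-- The equilibrium points of `y' = f y` in `U`. -/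
def equilibria (U : Set E) (f : E → E) : Set E := {y | y ∈ U ∧ f y = 0}

/-- The `ω`-limit set of the trajectory through `y₀`: the cluster points of `Φ t y₀` as
`t → ∞`, that is, the limits of `Φ (t k) y₀` along sequences `t k → ∞`. -/
def omegaSet (Φ : ℝ → E → E) (y₀ : E) : Set E := omegaLimit atTop Φ {y₀}

/-- The `α`-limit set of the trajectory through `y₀`: the same with `t → -∞`. -/
def alphaSet (Φ : ℝ → E → E) (y₀ : E) : Set E := omegaLimit atBot Φ {y₀}

/-- The orbit through `y`. -/
def orbitOf (Φ : ℝ → E → E) (y : E) : Set E := Set.range fun t => Φ t y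

/-- `S` is a periodic orbit: the orbit of a point of `U` that is not an equilibrium and whose
trajectory is periodic. -/
def IsPeriodicOrbit (U : Set E) (f : E → E) (Φ : ℝ → E → E) (S : Set E) : Prop :=
  ∃ p ∈ U, f p ≠ 0 ∧ (∃ T > 0, Function.Periodic (fun t => Φ t p) T) ∧ S = orbitOf Φ p

/-- `y` lies on a heteroclinic (`a ≠ b`) or homoclinic (`a = b`) orbit: it is not an equilibrium,
and its trajectory tends to an equilibrium `a` as `t → -∞` and to an equilibrium `b` as
`t → ∞`. -/
def OnConnectingOrbit (U : Set E) (f : E → E) (Φ : ℝ → E → E) (y : E) : Prop :=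
  f y ≠ 0 ∧ ∃ a ∈ equilibria U f, ∃ b ∈ equilibria U f,
    Tendsto (fun t => Φ t y) atBot (𝓝 a) ∧ Tendsto (fun t => Φ t y) atTop (𝓝 b)

/-- The version of `OnConnectingOrbit` for equilibria that may fill continua: `y` is not an
equilibrium, and its `α`- and `ω`-limit sets are nonempty, compact, connected sets of
equilibria. -/
def OnGeneralizedConnectingOrbit (U : Set E) (f : E → E) (Φ : ℝ → E → E) (y : E) : Prop :=
  f y ≠ 0 ∧
    (alphaSet Φ y ⊆ equilibria U f ∧ IsCompact (alphaSet Φ y) ∧ IsConnected (alphaSet Φ y)) ∧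
    (omegaSet Φ y ⊆ equilibria U f ∧ IsCompact (omegaSet Φ y) ∧ IsConnected (omegaSet Φ y))

end PlanarFlows

/-! ### Flows of continuous planar fields: from uniqueness to continuity. -/

section Flow

variable {E : Type*} [NormedAddCommGroup E] [NormedSpace ℝ E] {U : Set E} {f : E → E}
  {Φ : ℝ → E → E}

/-! The plane enters through a Jordan-type separation. Suppose an injective trajectory crosses a
transversal segment at two consecutive times. The arc between the crossings and the piece of segment
joining them form a closed curve, and the trajectory leaves on one side of it and cannot return to
the other. The winding number tells the sides apart: it is locally constant off the curve and jumps
across the segment. Crossings after an increasing consecutive pair therefore lie beyond it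
(`crossing_lt`), so the limit set meets the transversal in at most one point. Near a
non-equilibrium, it is then contained in one short orbit arc (`exists_nhds_limit_arc`).

If a non-equilibrium `y` of `L` has a non-equilibrium `α`- or `ω`-limit point, its orbit returns to
such an arc at arbitrarily large times, so `y` is periodic. Its orbit is closed, and relatively open
in `L` by the arc property, hence equal to the connected set `L`
(`isPeriodicOrbit_of_mapClusterPt`). Otherwise all these limit points are equilibria. This gives
(A); in (B), a connected set of equilibria in `L` is a point.

As `f` is only continuous, Grönwall estimates are not available; continuity of the flow follows from
uniqueness by compactness (`continuousAt_of_small`). -/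

lemma IsGlobalSolution.comp_add_const {γ : ℝ → E} (h : IsGlobalSolution U f γ) (s : ℝ) :
    IsGlobalSolution U f (fun t => γ (t + s)) :=
  ⟨fun _ => h.1 _, fun t => (h.2 (t + s)).comp_add_const t s⟩

namespace IsUniqueSolutionMap

lemma mem (h : IsUniqueSolutionMap U f Φ) {x : E} (hx : x ∈ U) (t : ℝ) : Φ t x ∈ U :=
  (h x hx).1.1.1 t

lemma hasDerivAt (h : IsUniqueSolutionMap U f Φ) {x : E} (hx : x ∈ U) (t : ℝ) :
    HasDerivAt (fun t => Φ t x) (f (Φ t x)) t :=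
  (h x hx).1.1.2 t

lemma map_zero (h : IsUniqueSolutionMap U f Φ) {x : E} (hx : x ∈ U) : Φ 0 x = x :=
  (h x hx).1.2

lemma eq_of_solution (h : IsUniqueSolutionMap U f Φ) {x : E} (hx : x ∈ U) {γ : ℝ → E}
    (hγ : IsGlobalSolution U f γ) (h0 : γ 0 = x) (t : ℝ) : γ t = Φ t x :=
  congrFun ((h x hx).2 γ hγ h0) t

lemma map_add (h : IsUniqueSolutionMap U f Φ) {x : E} (hx : x ∈ U) (t s : ℝ) :
    Φ (t + s) x = Φ t (Φ s x) :=
  h.eq_of_solution (h.mem hx s) ((h x hx).1.1.comp_add_const s) (by simp) t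

lemma continuous_trajectory (h : IsUniqueSolutionMap U f Φ) {x : E} (hx : x ∈ U) :
    Continuous fun t => Φ t x :=
  continuous_iff_continuousAt.2 fun t => (h.hasDerivAt hx t).continuousAt

lemma eq_self_of_eq_zero (h : IsUniqueSolutionMap U f Φ) {x : E} (hx : x ∈ U) (h0 : f x = 0)
    (t : ℝ) : Φ t x = x :=
  (h.eq_of_solution hx (γ := fun _ => x)
    ⟨fun _ => hx, fun t => by simpa [h0] using hasDerivAt_const t x⟩ rfl t).symm

lemma map_ne_zero (h : IsUniqueSolutionMap U f Φ) {x : E} (hx : x ∈ U) (h0 : f x ≠ 0) (t : ℝ) :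
    f (Φ t x) ≠ 0 := fun hz => h0 <| by
  have h1 := h.eq_self_of_eq_zero (h.mem hx t) hz (-t)
  rw [← h.map_add hx, neg_add_cancel, h.map_zero hx] at h1
  rwa [← h1] at hz

/-- A trajectory that takes the same value twice is periodic. -/
lemma periodic_of_eq (h : IsUniqueSolutionMap U f Φ) {x : E} (hx : x ∈ U) {s t : ℝ}
    (hst : Φ s x = Φ t x) : Function.Periodic (fun t => Φ t x) (t - s) := fun r => by
  change Φ (r + (t - s)) x = Φ r x
  rw [show r + (t - s) = (r - s) + t by ring, h.map_add hx, ← hst, ← h.map_add hx,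
    sub_add_cancel]

lemma exists_periodic_of_not_injective (h : IsUniqueSolutionMap U f Φ) {x : E} (hx : x ∈ U)
    (hinj : ¬ Function.Injective fun t => Φ t x) :
    ∃ T > 0, Function.Periodic (fun t => Φ t x) T := by
  simp only [Function.Injective, not_forall] at hinj
  obtain ⟨s, t, hst, hne⟩ := hinj
  rcases lt_or_gt_of_ne hne with hlt | hlt
  · exact ⟨t - s, sub_pos.2 hlt, h.periodic_of_eq hx hst⟩
  · exact ⟨s - t, sub_pos.2 hlt, h.periodic_of_eq hx hst.symm⟩

end IsUniqueSolutionMap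

/-- Two solutions that agree at time `c` can be glued there. -/
lemma hasDerivAt_ite_le {γ₁ γ₂ : ℝ → E} {c t : ℝ}
    (h₁ : t ≤ c → HasDerivAt γ₁ (f (γ₁ t)) t) (h₂ : c ≤ t → HasDerivAt γ₂ (f (γ₂ t)) t)
    (h : γ₁ c = γ₂ c) :
    HasDerivAt (fun t => if t ≤ c then γ₁ t else γ₂ t) (f (if t ≤ c then γ₁ t else γ₂ t)) t := by
  rcases lt_trichotomy t c with ht | rfl | ht
  · rw [if_pos ht.le]
    refine (h₁ ht.le).congr_of_eventuallyEq ?_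
    filter_upwards [Iio_mem_nhds ht] with s hs
    exact if_pos (le_of_lt hs)
  · rw [if_pos le_rfl]
    have hl : HasDerivWithinAt (fun s => if s ≤ t then γ₁ s else γ₂ s) (f (γ₁ t)) (Set.Iic t) t :=
      (h₁ le_rfl).hasDerivWithinAt.congr (fun s hs => if_pos hs) (if_pos le_rfl)
    have hr : HasDerivWithinAt (fun s => if s ≤ t then γ₁ s else γ₂ s) (f (γ₁ t)) (Set.Ici t) t := by
      rw [h]
      refine (h₂ le_rfl).hasDerivWithinAt.congr (fun s hs => ?_) (by simp [h])
      rcases (show t ≤ s from hs).eq_or_lt with rfl | hs'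
      · simp [h]
      · exact if_neg hs'.not_ge
    have := hl.union hr
    rwa [Set.Iic_union_Ici, hasDerivWithinAt_univ] at this
  · rw [if_neg ht.not_ge]
    refine (h₂ ht.le).congr_of_eventuallyEq ?_
    filter_upwards [Ioi_mem_nhds ht] with s hs
    exact if_neg (not_le.2 hs)

/-- Uniqueness for solutions that are only defined on an interval around `0`. -/
lemma IsUniqueSolutionMap.eq_of_local_solution (h : IsUniqueSolutionMap U f Φ) {x : E}
    {g : ℝ → E} {δ : ℝ} (hgU : ∀ t, |t| < δ → g t ∈ U)
    (hg : ∀ t, |t| < δ → HasDerivAt g (f (g t)) t) (h0 : g 0 = x) {t : ℝ} (ht : |t| < δ) :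
    g t = Φ t x := by
  obtain ⟨d, htd, hd⟩ := exists_between ht
  have hd0 : 0 < d := (abs_nonneg t).trans_lt htd
  have hx : x ∈ U := h0 ▸ hgU 0 (by simpa using hd0.trans hd)
  have hdU : g d ∈ U := hgU d (by rwa [abs_of_pos hd0])
  have hdU' : g (-d) ∈ U := hgU (-d) (by rwa [abs_neg, abs_of_pos hd0])
  have habs : ∀ s, -d ≤ s → s ≤ d → |s| < δ := fun s h1 h2 => (abs_le.2 ⟨h1, h2⟩).trans_lt hd
  -- Uniqueness is assumed only for global solutions, so `g` is extended beyond `±d` by the flow.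
  have hsol : IsGlobalSolution U f (fun s => if s ≤ -d then Φ (s + d) (g (-d)) else
      if s ≤ d then g s else Φ (s - d) (g d)) := by
    constructor
    · intro s
      dsimp only
      split_ifs with h1 h2
      · exact h.mem hdU' _
      · exact hgU _ (habs s (not_le.1 h1).le h2)
      · exact h.mem hdU _
    · intro s
      refine hasDerivAt_ite_le (f := f) (γ₁ := fun s => Φ (s + d) (g (-d)))
        (γ₂ := fun s => if s ≤ d then g s else Φ (s - d) (g d))
        (fun _ => (h.hasDerivAt hdU' (s + d)).comp_add_const s d) (fun h1 => ?_) ?_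
      · refine hasDerivAt_ite_le (f := f) (γ₁ := g) (γ₂ := fun s => Φ (s - d) (g d))
          (fun h2 => hg s (habs s h1 h2))
          (fun _ => (h.hasDerivAt hdU (s - d)).comp_sub_const s d) ?_
        simp [h.map_zero hdU]
      · simp [h.map_zero hdU', show -d ≤ d by linarith]
  have := h.eq_of_solution hx hsol (by simp [hd0, hd0.le, h0]) t
  obtain ⟨h1, h2⟩ := abs_lt.1 htd
  simpa [h1.not_ge, h2.le] using this

/-- A curve whose speed is less than `M` as long as it is `ρ`-close to its initial point. -/
lemma norm_sub_le_of_speed_lt {γ γ' : ℝ → E} (hγ : ∀ t, HasDerivAt γ (γ' t) t) {ρ M : ℝ}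
    (hM : ∀ t, ‖γ t - γ 0‖ ≤ ρ → ‖γ' t‖ < M) {T : ℝ} (hT : 0 ≤ T) (hTρ : M * T ≤ ρ) (hM0 : 0 ≤ M) :
    ‖γ T - γ 0‖ ≤ M * T := by
  refine image_norm_le_of_norm_deriv_right_lt_deriv_boundary (a := 0) (b := T)
    (f := fun t => γ t - γ 0) (f' := γ') (B := fun t => M * t) (B' := fun _ => M) ?_ ?_ ?_ ?_ ?_
    ⟨hT, le_rfl⟩
  · exact fun t _ => ((hγ t).continuousAt.sub continuousAt_const).continuousWithinAt
  · exact fun t _ => ((hγ t).sub_const _).hasDerivWithinAt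
  · simp
  · exact fun t => by simpa using (hasDerivAt_id t).const_mul M
  -- The speed bound is needed only at times when the boundary `M * t` is attained; there the curve
  -- is still in the ball, so no prior confinement is required.
  · intro t ht heq
    exact hM t (heq.le.trans ((mul_le_mul_of_nonneg_left ht.2.le hM0).trans hTρ))

/-- As long as the vector field has norm less than `M`, trajectories move at speed at most `M`. -/
lemma IsUniqueSolutionMap.norm_sub_le (h : IsUniqueSolutionMap U f Φ) {x : E} (hx : x ∈ U)
    {ρ M : ℝ} (hM : ∀ p ∈ Metric.closedBall x ρ, ‖f p‖ < M) (hM0 : 0 ≤ M) {s : ℝ}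
    (hs : M * |s| ≤ ρ) : ‖Φ s x - x‖ ≤ M * |s| := by
  have key : ∀ σ : ℝ, |σ| = 1 → ‖Φ (σ * |s|) x - x‖ ≤ M * |s| := by
    intro σ hσ
    have := norm_sub_le_of_speed_lt (γ := fun t => Φ (σ * t) x)
      (γ' := fun t => σ • f (Φ (σ * t) x)) (ρ := ρ) (M := M)
      (fun t => by
        have h1 : HasDerivAt (fun t : ℝ => σ * t) σ t := by
          simpa using (hasDerivAt_id t).const_mul σ
        exact (h.hasDerivAt hx (σ * t)).scomp t h1)
      (fun t ht => by
        rw [norm_smul, Real.norm_eq_abs, hσ, one_mul]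
        refine hM _ ?_
        simpa [h.map_zero hx, dist_eq_norm] using ht) (abs_nonneg s) hs hM0
    simpa [h.map_zero hx] using this
  rcases abs_cases s with ⟨h1, -⟩ | ⟨h1, -⟩
  · simpa [h1] using key 1 (by simp)
  · simpa [h1] using key (-1) (by simp)

lemma exists_closedBall_bound {F : Type*} [NormedAddCommGroup F] [ProperSpace F] {U : Set F}
    {f : F → F} (hU : IsOpen U) (hf : ContinuousOn f U) {y : F} (hy : y ∈ U) :
    ∃ r > 0, ∃ M > 0, Metric.closedBall y r ⊆ U ∧ ∀ p ∈ Metric.closedBall y r, ‖f p‖ < M := by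
  obtain ⟨r, hr, hrU⟩ := Metric.nhds_basis_closedBall.mem_iff.1 (hU.mem_nhds hy)
  obtain ⟨M, hM⟩ := (isCompact_closedBall y r).exists_bound_of_continuousOn (hf.mono hrU)
  exact ⟨r, hr, max M 0 + 1, by positivity, hrU, fun p hp =>
    ((hM p hp).trans (le_max_left _ _)).trans_lt (lt_add_one _)⟩

/-- A quantitative form of the differential equation: it survives pointwise limits of solutions, so
such limits are again solutions. -/
lemma IsUniqueSolutionMap.norm_linearization_le (h : IsUniqueSolutionMap U f Φ) {x : E}
    (hx : x ∈ U) {t s η : ℝ}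
    (hη : ∀ r ∈ Set.uIcc t s, ‖f (Φ r x) - f (Φ t x)‖ ≤ η) :
    ‖Φ s x - Φ t x - (s - t) • f (Φ t x)‖ ≤ η * |s - t| := by
  have hd : ∀ r ∈ Set.uIcc t s, HasDerivWithinAt (fun r => Φ r x - r • f (Φ t x))
      (f (Φ r x) - f (Φ t x)) (Set.uIcc t s) r := fun r _ => by
    have := (h.hasDerivAt hx r).fun_sub ((hasDerivAt_id r).smul_const (f (Φ t x)))
    simpa using this.hasDerivWithinAt
  have := (convex_uIcc t s).norm_image_sub_le_of_norm_hasDerivWithin_le hd hη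
    Set.left_mem_uIcc Set.right_mem_uIcc
  rw [Real.norm_eq_abs] at this
  convert this using 2
  rw [sub_smul]; abel

/-- Continuous dependence on the initial value for short times, with an explicit time bound. -/
lemma IsUniqueSolutionMap.continuousAt_of_small [ProperSpace E] (h : IsUniqueSolutionMap U f Φ)
    (hU : IsOpen U) (hf : ContinuousOn f U) {y : E} {r M : ℝ} (hr : 0 < r) (hM0 : 0 < M)
    (hrU : Metric.closedBall y r ⊆ U) (hM : ∀ p ∈ Metric.closedBall y r, ‖f p‖ < M) {t : ℝ}
    (ht : |t| < r / (2 * M)) : ContinuousAt (Φ t) y := by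
  have hyU : y ∈ U := hrU (Metric.mem_closedBall_self hr.le)
  -- At speed at most `M`, a start within `r / 2` of `y` stays within `r` of `y` for this long.
  set δ := r / (2 * M) with hδ
  have hMδ : M * δ = r / 2 := by rw [hδ]; field_simp
  have hstay : ∀ x ∈ Metric.closedBall y (r / 2), ∀ s, |s| ≤ δ → Φ s x ∈ Metric.closedBall y r := by
    intro x hx s hs
    have hsub : Metric.closedBall x (r / 2) ⊆ Metric.closedBall y r :=
      Metric.closedBall_subset_closedBall' (by have := Metric.mem_closedBall.1 hx; linarith)
    have hMs : M * |s| ≤ r / 2 := hMδ ▸ mul_le_mul_of_nonneg_left hs hM0.le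
    have := h.norm_sub_le (hrU (hsub (Metric.mem_closedBall_self (by linarith))))
      (fun p hp => hM p (hsub hp)) hM0.le hMs
    exact hsub (by rw [Metric.mem_closedBall, dist_eq_norm]; linarith)
  have hlip : ∀ x ∈ Metric.closedBall y (r / 2), ∀ s s', |s| ≤ δ → |s'| ≤ δ →
      ‖Φ s' x - Φ s x‖ ≤ M * |s' - s| := by
    intro x hx s s' hs hs'
    have hxU : x ∈ U := hrU (Metric.closedBall_subset_closedBall (by linarith) hx)
    have := (convex_Icc (-δ) δ).norm_image_sub_le_of_norm_hasDerivWithin_le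
      (f := fun s => Φ s x) (f' := fun s => f (Φ s x)) (C := M)
      (fun s _ => (h.hasDerivAt hxU s).hasDerivWithinAt)
      (fun s hs => (hM _ (hstay x hx s (abs_le.2 hs))).le) (abs_le.1 hs) (abs_le.1 hs')
    simpa using this
  -- Along an ultrafilter converging to `y`, compactness makes the trajectories converge at each
  -- time. The limit curve solves the equation from `y`, so uniqueness identifies it with the
  -- trajectory of `y`.
  rw [ContinuousAt, tendsto_iff_ultrafilter]
  intro 𝒰 h𝒰
  have hball : ∀ᶠ x in (𝒰 : Filter E), x ∈ Metric.closedBall y (r / 2) :=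
    h𝒰 (Metric.closedBall_mem_nhds y (by linarith))
  have hlim : ∀ s, ∃ q, |s| ≤ δ → q ∈ Metric.closedBall y r ∧ Tendsto (Φ s) 𝒰 (𝓝 q) := by
    intro s
    by_cases hs : |s| ≤ δ
    · obtain ⟨q, hq, hq'⟩ := (isCompact_closedBall y r).ultrafilter_le_nhds (𝒰.map (Φ s))
        (le_principal_iff.2 (Ultrafilter.mem_map.2
          (mem_of_superset hball fun x hx => hstay x hx s hs)))
      exact ⟨q, fun _ => ⟨hq, hq'⟩⟩
    · exact ⟨0, fun h => absurd h hs⟩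
  choose g hg using hlim
  have hδ0 : 0 < δ := (abs_nonneg t).trans_lt ht
  have hg0 : g 0 = y := by
    have h1 := (hg 0 (by simpa using hδ0.le)).2
    have h2 : Tendsto (Φ 0) 𝒰 (𝓝 y) := by
      refine (tendsto_id'.2 h𝒰).congr' ?_
      filter_upwards [h𝒰 (hU.mem_nhds hyU)] with x hx using (h.map_zero hx).symm
    exact tendsto_nhds_unique h1 h2
  have hderiv : ∀ s, |s| < δ → HasDerivAt g (f (g s)) s := by
    intro s hs
    obtain ⟨hgs, hgs'⟩ := hg s hs.le
    rw [hasDerivAt_iff_isLittleO, Asymptotics.isLittleO_iff]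
    intro η hη
    obtain ⟨κ, hκ, hκ'⟩ := Metric.uniformContinuousOn_iff.1
      ((isCompact_closedBall y r).uniformContinuousOn_of_continuous (hf.mono hrU)) η hη
    have hnear : ∀ᶠ s' in 𝓝 s, M * |s' - s| < κ := by
      have : ContinuousAt (fun s' => M * |s' - s|) s := by fun_prop
      exact this.eventually (gt_mem_nhds (by simpa using hκ))
    have hnear' : ∀ᶠ s' in 𝓝 s, |s'| < δ :=
      continuous_abs.continuousAt.eventually (gt_mem_nhds hs)
    filter_upwards [hnear, hnear'] with s' hs1 hs2
    obtain ⟨-, hgs2⟩ := hg s' hs2.le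
    have hfc : ContinuousAt f (g s) := hf.continuousAt (hU.mem_nhds (hrU hgs))
    have hT : Tendsto (fun x => ‖Φ s' x - Φ s x - (s' - s) • f (Φ s x)‖) 𝒰
        (𝓝 ‖g s' - g s - (s' - s) • f (g s)‖) :=
      ((hgs2.sub hgs').sub ((hfc.tendsto.comp hgs').const_smul (s' - s))).norm
    rw [Real.norm_eq_abs]
    refine le_of_tendsto hT ?_
    filter_upwards [hball] with x hx
    refine h.norm_linearization_le (hrU (Metric.closedBall_subset_closedBall (by linarith) hx))
      fun p hp => ?_
    have hpδ : |p| ≤ δ :=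
      abs_le.2 ((Set.uIcc_subset_Icc (abs_le.1 hs.le) (abs_le.1 hs2.le)) hp)
    have hps : |p - s| ≤ |s' - s| := Set.abs_sub_left_of_mem_uIcc hp
    have := hκ' _ (hstay x hx p hpδ) _ (hstay x hx s hs.le) (by
      rw [dist_eq_norm]
      exact ((hlip x hx s p hs.le hpδ).trans
        (mul_le_mul_of_nonneg_left hps hM0.le)).trans_lt hs1)
    rw [dist_eq_norm] at this
    exact this.le
  have := h.eq_of_local_solution (fun s hs => hrU (hg s hs.le).1) hderiv hg0 ht
  rw [← this]
  exact (hg t ht.le).2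

/-- The good times form a clopen set containing `0`: one ball around `Φ t₀ y` gives a common step
length for all times near `t₀`, so continuity passes between any two of them. -/
lemma IsUniqueSolutionMap.continuousAt_map [ProperSpace E] (h : IsUniqueSolutionMap U f Φ)
    (hU : IsOpen U) (hf : ContinuousOn f U) {y : E} (hy : y ∈ U) (t : ℝ) :
    ContinuousAt (Φ t) y := by
  have key : ∀ t₀, ∀ᶠ p in 𝓝 (t₀, t₀), ContinuousAt (Φ (Prod.fst p)) y →
      ContinuousAt (Φ (Prod.snd p)) y := by
    intro t₀
    obtain ⟨r, hr, M, hM0, hrU, hM⟩ := exists_closedBall_bound hU hf (h.mem hy t₀)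
    have h1 : ∀ᶠ p in 𝓝 (t₀, t₀), Φ (Prod.fst p) y ∈ Metric.closedBall (Φ t₀ y) (r / 2) :=
      ((h.continuous_trajectory hy).comp continuous_fst).continuousAt.eventually
        (Metric.closedBall_mem_nhds _ (by linarith))
    have h2 : ∀ᶠ p in 𝓝 (t₀, t₀), |Prod.snd p - Prod.fst p| < r / 2 / (2 * M) :=
      (show ContinuousAt (fun p : ℝ × ℝ => |p.2 - p.1|) (t₀, t₀) by fun_prop).eventually
        (gt_mem_nhds (by simp; positivity))
    filter_upwards [h1, h2] with p hp1 hp2 hc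
    have hsub : Metric.closedBall (Φ p.1 y) (r / 2) ⊆ Metric.closedBall (Φ t₀ y) r :=
      Metric.closedBall_subset_closedBall' (by have := Metric.mem_closedBall.1 hp1; linarith)
    have h3 := h.continuousAt_of_small hU hf (by linarith : 0 < r / 2) hM0 (hsub.trans hrU)
      (fun q hq => hM q (hsub hq)) hp2
    refine (ContinuousAt.comp (f := Φ p.1) h3 hc).congr ?_
    filter_upwards [hU.mem_nhds hy] with x hx
    rw [Function.comp, ← h.map_add hx, sub_add_cancel]
  have hopen : IsClopen {t | ContinuousAt (Φ t) y} := by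
    constructor
    · rw [← isOpen_compl_iff, isOpen_iff_mem_nhds]
      intro t₀ ht₀
      have := ((Continuous.prodMk_left t₀).continuousAt (x := t₀)).eventually (key t₀)
      filter_upwards [this] with s hs hs'
      exact ht₀ (hs hs')
    · rw [isOpen_iff_mem_nhds]
      intro t₀ ht₀
      have := ((Continuous.prodMk_right t₀).continuousAt (x := t₀)).eventually (key t₀)
      filter_upwards [this] with s hs
      exact hs ht₀
  have h0 : (0 : ℝ) ∈ {t | ContinuousAt (Φ t) y} := by
    refine continuousAt_id.congr ?_
    filter_upwards [hU.mem_nhds hy] with x hx using (h.map_zero hx).symm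
  exact (hopen.eq_univ ⟨0, h0⟩).ge (Set.mem_univ t)

/-- Continuous dependence on time and initial value. -/
theorem IsUniqueSolutionMap.continuousAt [ProperSpace E] (h : IsUniqueSolutionMap U f Φ)
    (hU : IsOpen U) (hf : ContinuousOn f U) {y : E} (hy : y ∈ U) (t : ℝ) :
    ContinuousAt (fun p : ℝ × E => Φ p.1 p.2) (t, y) := by
  have hzero : ∀ x ∈ U, ContinuousAt (fun p : ℝ × E => Φ p.1 p.2) (0, x) := by
    intro x hx
    obtain ⟨r, hr, M, hM0, hrU, hM⟩ := exists_closedBall_bound hU hf hx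
    have h1 : ∀ᶠ p in 𝓝 ((0 : ℝ), x), M * |Prod.fst p| < r / 2 :=
      (show ContinuousAt (fun p : ℝ × E => M * |p.1|) (0, x) by fun_prop).eventually
        (gt_mem_nhds (by simpa using hr))
    have h2 : ∀ᶠ p in 𝓝 ((0 : ℝ), x), Prod.snd p ∈ Metric.closedBall x (r / 2) :=
      continuous_snd.continuousAt.eventually (Metric.closedBall_mem_nhds _ (by linarith))
    have h3 : Tendsto (fun p : ℝ × E => Φ p.1 p.2 - p.2) (𝓝 (0, x)) (𝓝 0) := by
      refine squeeze_zero_norm' (a := fun p : ℝ × E => M * |p.1|) ?_ ?_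
      · filter_upwards [h1, h2] with p hp1 hp2
        have hsub : Metric.closedBall p.2 (r / 2) ⊆ Metric.closedBall x r :=
          Metric.closedBall_subset_closedBall' (by have := Metric.mem_closedBall.1 hp2; linarith)
        exact h.norm_sub_le (hrU (hsub (Metric.mem_closedBall_self (by linarith))))
          (fun q hq => hM q (hsub hq)) hM0.le hp1.le
      · have : ContinuousAt (fun p : ℝ × E => M * |p.1|) (0, x) := by fun_prop
        simpa [ContinuousAt] using this
    have h4 := h3.add (continuous_snd.continuousAt (x := ((0 : ℝ), x))).tendsto
    simpa [ContinuousAt, h.map_zero hx] using h4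
  have h1 : ContinuousAt (fun p : ℝ × E => (p.1 - t, Φ t p.2)) (t, y) :=
    (continuous_fst.sub continuous_const).continuousAt.prodMk
      (ContinuousAt.comp (f := Prod.snd) (g := Φ t) (h.continuousAt_map hU hf hy t)
        continuous_snd.continuousAt)
  have h2 := ContinuousAt.comp (f := fun p : ℝ × E => (p.1 - t, Φ t p.2))
    (g := fun p : ℝ × E => Φ p.1 p.2) (x := (t, y))
    (by simpa using hzero _ (h.mem hy t)) h1
  refine h2.congr ?_
  filter_upwards [continuous_snd.continuousAt.eventually (hU.mem_nhds hy)] with p hp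
  simp only [Function.comp]
  rw [← h.map_add hp, sub_add_cancel]

end Flow

/-! ### Cluster sets of curves in compact sets. -/

section LimitSets

variable {X : Type*} [TopologicalSpace X] {τ : Type*}

lemma omegaLimit_singleton_eq (F : Filter τ) (Φ : τ → X → X) (y : X) :
    omegaLimit F Φ {y} = {x | MapClusterPt x F fun t => Φ t y} := by
  ext x
  exact mem_omegaLimit_singleton_iff_mapClusterPt F Φ y x

/-- The cluster points of a curve that stays in a compact set. -/
lemma clusterSet_subset {γ : τ → X} {F : Filter τ} {K : Set X} (hK : IsClosed K)
    (h : ∀ᶠ t in F, γ t ∈ K) : {x | MapClusterPt x F γ} ⊆ K := fun x hx => by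
  have h1 : ClusterPt x (𝓟 K) := ClusterPt.mono hx (le_principal_iff.2 h)
  exact isClosed_iff_clusterPt.1 hK x h1

lemma isClosed_clusterSet (γ : τ → X) (F : Filter τ) : IsClosed {x | MapClusterPt x F γ} :=
  isClosed_setOfPred_clusterPt

lemma clusterSet_nonempty {γ : τ → X} {F : Filter τ} [F.NeBot] {K : Set X} (hK : IsCompact K)
    (h : ∀ᶠ t in F, γ t ∈ K) : {x | MapClusterPt x F γ}.Nonempty := by
  obtain ⟨x, -, hx⟩ := hK.exists_mapClusterPt_of_frequently h.frequently
  exact ⟨x, hx⟩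

/-- A curve in a compact set eventually enters every open set containing its cluster points. -/
lemma eventually_mem_of_clusterSet_subset {γ : τ → X} {F : Filter τ} {K O : Set X}
    (hK : IsCompact K) (h : ∀ᶠ t in F, γ t ∈ K) (hO : IsOpen O)
    (hsub : {x | MapClusterPt x F γ} ⊆ O) : ∀ᶠ t in F, γ t ∈ O := by
  by_contra hcon
  have hfr : ∃ᶠ t in F, γ t ∈ K \ O := (not_eventually.1 hcon).and_eventually h |>.mono
    fun t ht => ⟨ht.2, ht.1⟩
  obtain ⟨x, hx, hx'⟩ := (hK.diff hO).exists_mapClusterPt_of_frequently hfr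
  exact hx.2 (hsub hx')

/-- The cluster set of a curve in a compact set is connected. -/
lemma isConnected_clusterSet [T2Space X] {γ : ℝ → X} (hγ : Continuous γ) {F : Filter ℝ} [F.NeBot]
    (hF : F.HasBasis (fun _ : ℝ => True) Set.Ici ∨ F.HasBasis (fun _ : ℝ => True) Set.Iic)
    {K : Set X} (hK : IsCompact K) (h : ∀ᶠ t in F, γ t ∈ K) :
    IsConnected {x | MapClusterPt x F γ} := by
  refine ⟨clusterSet_nonempty hK h, ?_⟩
  have hLc : IsCompact {x | MapClusterPt x F γ} :=
    hK.of_isClosed_subset (isClosed_clusterSet γ F) (clusterSet_subset hK.isClosed h)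
  rw [isPreconnected_closed_iff]
  by_contra! hcon
  obtain ⟨A, B, hA, hB, hAB, ⟨a, haL, haA⟩, ⟨b, hbL, hbB⟩, hemp⟩ := hcon
  have hdisj : Disjoint ({x | MapClusterPt x F γ} ∩ A) ({x | MapClusterPt x F γ} ∩ B) := by
    rw [Set.disjoint_iff_inter_eq_empty, ← hemp]
    ext x; simp only [Set.mem_inter_iff]; tauto
  obtain ⟨V, W, hV, hW, hAV, hBW, hVW⟩ :=
    SeparatedNhds.of_isCompact_isCompact (hLc.inter_right hA) (hLc.inter_right hB) hdisj
  have hev := eventually_mem_of_clusterSet_subset hK h (hV.union hW) fun x hx =>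
    (hAB hx).imp (fun hxA => hAV ⟨hx, hxA⟩) (fun hxB => hBW ⟨hx, hxB⟩)
  have hfrA : ∃ᶠ t in F, γ t ∈ V := haL.frequently (hV.mem_nhds (hAV ⟨haL, haA⟩))
  have hfrB : ∃ᶠ t in F, γ t ∈ W := hbL.frequently (hW.mem_nhds (hBW ⟨hbL, hbB⟩))
  -- A tail of the filter is an interval, so its image is connected; yet it lies in `V ∪ W` and
  -- meets both.
  obtain ⟨S, hS, hSF, hSc⟩ : ∃ S : Set ℝ, IsPreconnected S ∧ S ∈ F ∧ ∀ t ∈ S, γ t ∈ V ∪ W := by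
    rcases hF with hF | hF
    · obtain ⟨c, -, hc⟩ := hF.mem_iff.1 hev
      exact ⟨_, isPreconnected_Ici, hF.mem_of_mem trivial, hc⟩
    · obtain ⟨c, -, hc⟩ := hF.mem_iff.1 hev
      exact ⟨_, isPreconnected_Iic, hF.mem_of_mem trivial, hc⟩
  obtain ⟨s, hsV, hsS⟩ := (hfrA.and_eventually hSF).exists
  obtain ⟨t, htW, htS⟩ := (hfrB.and_eventually hSF).exists
  obtain ⟨x, -, hxV, hxW⟩ := (hS.image γ hγ.continuousOn) V W hV hW
    (Set.image_subset_iff.2 hSc) ⟨_, ⟨s, hsS, rfl⟩, hsV⟩ ⟨_, ⟨t, htS, rfl⟩, htW⟩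
  exact hVW.le_bot ⟨hxV, hxW⟩

lemma tendsto_of_clusterSet_eq_singleton {γ : τ → X} {F : Filter τ} {K : Set X}
    (hK : IsCompact K) (h : ∀ᶠ t in F, γ t ∈ K) {a : X}
    (ha : {x | MapClusterPt x F γ} = {a}) : Tendsto γ F (𝓝 a) := by
  intro O hO
  obtain ⟨O', hO', hopen, haO⟩ := mem_nhds_iff.1 hO
  rw [mem_map]
  filter_upwards [eventually_mem_of_clusterSet_subset (γ := γ) hK h hopen (by
    rw [ha]; exact Set.singleton_subset_iff.2 haO)] with t ht using hO' ht

end LimitSets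

/-! ### Winding number of an arc closed by a real segment. -/

section Winding

/-- `2πi` times the winding number around `x` of the closed curve that consists of `γ` on `[a, b]`
and of the segment from `γ b` to `γ a`. -/
noncomputable def closedArcIndex (γ γ' : ℝ → ℂ) (a b : ℝ) (x : ℂ) : ℂ :=
  (∫ t in a..b, γ' t / (γ t - x)) + Complex.log ((γ a - x) / (γ b - x))

variable {γ γ' : ℝ → ℂ} {a b : ℝ}

lemma exp_integral_div_sub (hγ : ∀ t, HasDerivAt γ (γ' t) t) (hγ' : Continuous γ') (hab : a ≤ b)
    {x : ℂ} (hx : ∀ t ∈ Set.Icc a b, γ t ≠ x) :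
    Complex.exp (∫ t in a..b, γ' t / (γ t - x)) = (γ b - x) / (γ a - x) := by
  have hγc : Continuous γ := continuous_iff_continuousAt.2 fun t => (hγ t).continuousAt
  have hcont : ContinuousOn (fun t => γ' t / (γ t - x)) {t | γ t ≠ x} :=
    hγ'.continuousOn.div (by fun_prop) fun t ht => sub_ne_zero.2 ht
  have hopen : IsOpen {t | γ t ≠ x} := isOpen_ne_fun hγc continuous_const
  -- The exponential of minus the integral, times `γ t - x`, is a constant of motion.
  have hderiv : ∀ t ∈ Set.Icc a b,
      HasDerivAt (fun t => Complex.exp (-∫ s in a..t, γ' s / (γ s - x)) * (γ t - x)) 0 t := by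
    intro t ht
    have hint : IntervalIntegrable (fun t => γ' t / (γ t - x)) MeasureTheory.volume a t := by
      refine (hcont.mono ?_).intervalIntegrable
      rw [Set.uIcc_of_le ht.1]
      exact fun s hs => hx s ⟨hs.1, hs.2.trans ht.2⟩
    have h1 := intervalIntegral.integral_hasDerivAt_right hint
      (hcont.stronglyMeasurableAtFilter hopen t (hx t ht))
      (hcont.continuousAt (hopen.mem_nhds (hx t ht)))
    have h2 := h1.fun_neg.cexp.mul ((hγ t).sub_const x)
    refine h2.congr_deriv ?_
    have := sub_ne_zero.2 (hx t ht)
    field_simp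
    ring
  have h := constant_of_has_deriv_right_zero
    (fun t ht => (hderiv t ht).continuousAt.continuousWithinAt)
    (fun t ht => (hderiv t (Set.Ico_subset_Icc_self ht)).hasDerivWithinAt) b ⟨hab, le_rfl⟩
  simp only [intervalIntegral.integral_same, neg_zero, Complex.exp_zero, one_mul] at h
  have ha := sub_ne_zero.2 (hx a ⟨le_rfl, hab⟩)
  rw [← h, Complex.exp_neg]
  have hb := sub_ne_zero.2 (hx b ⟨hab, le_rfl⟩)
  field_simp [Complex.exp_ne_zero]

lemma exp_closedArcIndex (hγ : ∀ t, HasDerivAt γ (γ' t) t) (hγ' : Continuous γ') (hab : a ≤ b)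
    {x : ℂ} (hx : ∀ t ∈ Set.Icc a b, γ t ≠ x) : Complex.exp (closedArcIndex γ γ' a b x) = 1 := by
  have ha := sub_ne_zero.2 (hx a ⟨le_rfl, hab⟩)
  have hb := sub_ne_zero.2 (hx b ⟨hab, le_rfl⟩)
  rw [closedArcIndex, Complex.exp_add, exp_integral_div_sub hγ hγ' hab hx,
    Complex.exp_log (div_ne_zero ha hb)]
  field_simp

lemma continuousAt_integral_div_sub (hγ : Continuous γ) (hγ' : Continuous γ') (hab : a ≤ b)
    {x : ℂ} (hx : ∀ t ∈ Set.Icc a b, γ t ≠ x) :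
    ContinuousAt (fun x => ∫ t in a..b, γ' t / (γ t - x)) x := by
  obtain ⟨d, hd, hdist⟩ : ∃ d > 0, ∀ t ∈ Set.Icc a b, d ≤ ‖γ t - x‖ := by
    obtain ⟨t₀, ht₀, hmin⟩ := isCompact_Icc.exists_isMinOn (Set.nonempty_Icc.2 hab)
      (f := fun t => ‖γ t - x‖) (by fun_prop)
    exact ⟨_, norm_pos_iff.2 (sub_ne_zero.2 (hx t₀ ht₀)), fun t ht => hmin ht⟩
  have hI : Set.uIoc a b ⊆ Set.Icc a b := by
    rw [Set.uIoc_of_le hab]; exact Set.Ioc_subset_Icc_self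
  refine intervalIntegral.continuousAt_of_dominated_interval
    (bound := fun t => ‖γ' t‖ / (d / 2)) ?_ ?_ ?_ ?_
  · refine Eventually.of_forall fun y => ?_
    exact (hγ'.measurable.div (hγ.measurable.sub_const y)).aestronglyMeasurable
  · filter_upwards [Metric.ball_mem_nhds x (half_pos hd)] with y hy
    refine Eventually.of_forall fun t ht => ?_
    rw [norm_div]
    have h1 := hdist t (hI ht)
    have h2 : ‖γ t - x‖ ≤ ‖γ t - y‖ + ‖y - x‖ := norm_sub_le_norm_sub_add_norm_sub _ _ _
    have h3 : ‖y - x‖ < d / 2 := by rwa [← dist_eq_norm]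
    gcongr
    linarith
  · exact (by fun_prop : Continuous fun t => ‖γ' t‖ / (d / 2)).intervalIntegrable _ _
  · refine Eventually.of_forall fun t ht => ?_
    have := sub_ne_zero.2 (hx t (hI ht))
    fun_prop (disch := assumption)

lemma im_ofReal_sub_div (u v : ℝ) (x : ℂ) :
    (((u : ℂ) - x) / (v - x)).im = x.im * (u - v) / Complex.normSq (v - x) := by
  rw [Complex.div_im]
  simp only [Complex.sub_re, Complex.sub_im, Complex.ofReal_re, Complex.ofReal_im]
  ring

/-- Off the segment the quotient avoids the branch cut, so the principal logarithm in
`closedArcIndex` is continuous there. -/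
lemma sub_div_mem_slitPlane {u v : ℝ} (huv : u < v) {x : ℂ}
    (hx : ∀ w ∈ Set.Icc u v, (w : ℂ) ≠ x) : ((u : ℂ) - x) / (v - x) ∈ Complex.slitPlane := by
  have hv : (v : ℂ) - x ≠ 0 := sub_ne_zero.2 (hx v ⟨huv.le, le_rfl⟩)
  by_cases him : x.im = 0
  · obtain ⟨w, rfl⟩ : ∃ w : ℝ, (w : ℂ) = x := ⟨x.re, by apply Complex.ext <;> simp [him]⟩
    rw [← Complex.ofReal_sub, ← Complex.ofReal_sub, ← Complex.ofReal_div,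
      Complex.ofReal_mem_slitPlane]
    have hw : w < u ∨ v < w := by
      by_contra! hcon
      exact hx w hcon rfl
    rcases hw with hw | hw
    · exact div_pos (by linarith) (by linarith)
    · exact div_pos_of_neg_of_neg (by linarith) (by linarith)
  · refine Complex.mem_slitPlane_iff.2 (Or.inr ?_)
    rw [im_ofReal_sub_div]
    exact div_ne_zero (mul_ne_zero him (by linarith)) (Complex.normSq_pos.2 hv).ne'

lemma continuousAt_closedArcIndex (hγ : Continuous γ) (hγ' : Continuous γ') (hab : a ≤ b)
    {u v : ℝ} (ha : γ a = u) (hb : γ b = v) (huv : u < v) {x : ℂ}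
    (hx : ∀ t ∈ Set.Icc a b, γ t ≠ x) (hx' : ∀ w ∈ Set.Icc u v, (w : ℂ) ≠ x) :
    ContinuousAt (closedArcIndex γ γ' a b) x := by
  refine (continuousAt_integral_div_sub hγ hγ' hab hx).add ?_
  rw [ha, hb]
  have hv : (v : ℂ) - x ≠ 0 := sub_ne_zero.2 (hx' v ⟨huv.le, le_rfl⟩)
  exact ContinuousAt.clog (by fun_prop (disch := assumption)) (sub_div_mem_slitPlane huv hx')

/-- The index is constant on connected sets that do not meet the closed curve. -/
lemma closedArcIndex_eq_of_isPreconnected (hγ : ∀ t, HasDerivAt γ (γ' t) t) (hγ' : Continuous γ')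
    (hab : a ≤ b) {u v : ℝ} (ha : γ a = u) (hb : γ b = v) (huv : u < v) {S : Set ℂ}
    (hS : IsPreconnected S) (h₁ : ∀ x ∈ S, ∀ t ∈ Set.Icc a b, γ t ≠ x)
    (h₂ : ∀ x ∈ S, ∀ w ∈ Set.Icc u v, (w : ℂ) ≠ x) {x y : ℂ} (hx : x ∈ S) (hy : y ∈ S) :
    closedArcIndex γ γ' a b x = closedArcIndex γ γ' a b y := by
  have hγc : Continuous γ := continuous_iff_continuousAt.2 fun t => (hγ t).continuousAt
  have hcount : {z : ℂ | Complex.exp z = 1}.Countable := by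
    refine (Set.countable_range fun n : ℤ => (n : ℂ) * (2 * Real.pi * Complex.I)).mono ?_
    intro z hz
    obtain ⟨n, hn⟩ := Complex.exp_eq_one_iff.1 hz
    exact ⟨n, hn.symm⟩
  refine hcount.isTotallyDisconnected (closedArcIndex γ γ' a b '' S) ?_
    (hS.image _ fun x hx => (continuousAt_closedArcIndex hγc hγ' hab ha hb huv
      (h₁ x hx) (h₂ x hx)).continuousWithinAt) ⟨x, hx, rfl⟩ ⟨y, hy, rfl⟩
  rintro _ ⟨z, hz, rfl⟩
  exact exp_closedArcIndex hγ hγ' hab (h₁ z hz)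

/-- The index jumps across the segment. -/
lemma closedArcIndex_jump (hγ : Continuous γ) (hγ' : Continuous γ') (hab : a ≤ b)
    {u v w : ℝ} (ha : γ a = u) (hb : γ b = v) (huw : u < w) (hwv : w < v)
    (hw : ∀ t ∈ Set.Icc a b, γ t ≠ w) {g : ℝ → ℂ} (hg : ContinuousAt g 0) (hg0 : g 0 = w)
    {δ : ℝ} (hδ : 0 < δ) (hpos : ∀ s ∈ Set.Ioc 0 δ, 0 < (g s).im)
    (hneg : ∀ s ∈ Set.Ioc 0 δ, (g (-s)).im < 0) {α β : ℂ}
    (hα : ∀ s ∈ Set.Ioc 0 δ, closedArcIndex γ γ' a b (g s) = α)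
    (hβ : ∀ s ∈ Set.Ioc 0 δ, closedArcIndex γ γ' a b (g (-s)) = β) : α ≠ β := by
  set q : ℂ → ℂ := fun x => ((u : ℂ) - x) / (v - x) with hq
  have huv : u < v := huw.trans hwv
  have hvw : (v : ℂ) - w ≠ 0 := by
    rw [← Complex.ofReal_sub]; exact Complex.ofReal_ne_zero.2 (by linarith)
  -- For `w` inside the segment `q w` is a negative real: the two sides approach the branch cut from
  -- opposite sides, and the logarithm jumps by `2πi` while the integral is continuous.
  have hqw : q w = ((u - w) / (v - w) : ℝ) := by simp [hq]
  have hqre : (q w).re < 0 := by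
    rw [hqw, Complex.ofReal_re]
    exact div_neg_of_neg_of_pos (by linarith) (by linarith)
  have hqim : (q w).im = 0 := by rw [hqw, Complex.ofReal_im]
  have hqc : ContinuousAt q w := by
    simp only [hq]; fun_prop (disch := assumption)
  have hnsq : ∀ x : ℂ, x.im ≠ 0 → 0 < Complex.normSq ((v : ℂ) - x) := fun x hx =>
    Complex.normSq_pos.2 fun h => hx (by simpa using congrArg Complex.im h)
  have hI : Set.Ioc (0 : ℝ) δ ∈ 𝓝[>] (0 : ℝ) := Ioc_mem_nhdsGT hδ
  have hg' : ContinuousAt (fun s => g (-s)) 0 :=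
    ContinuousAt.comp (f := fun s : ℝ => -s) (g := g) (by simpa using hg) (by fun_prop)
  have hint := (continuousAt_integral_div_sub hγ hγ' hab hw).tendsto
  have h1 : Tendsto g (𝓝[>] 0) (𝓝 w) := hg0 ▸ hg.tendsto.mono_left nhdsWithin_le_nhds
  have h2 : Tendsto (fun s => g (-s)) (𝓝[>] 0) (𝓝 w) := by
    have := hg'.tendsto.mono_left (nhdsWithin_le_nhds (s := Set.Ioi 0))
    simpa [hg0] using this
  have hlog1 : Tendsto (fun s => Complex.log (q (g s))) (𝓝[>] 0)
      (𝓝 (Real.log ‖q w‖ - Real.pi * Complex.I)) := by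
    refine (Complex.tendsto_log_nhdsWithin_im_neg_of_re_neg_of_im_zero hqre hqim).comp
      (tendsto_nhdsWithin_iff.2 ⟨hqc.tendsto.comp h1, ?_⟩)
    filter_upwards [hI] with s hs
    have := hpos s hs
    change (q (g s)).im < 0
    rw [hq, im_ofReal_sub_div]
    exact div_neg_of_neg_of_pos (mul_neg_of_pos_of_neg this (by linarith)) (hnsq _ this.ne')
  have hlog2 : Tendsto (fun s => Complex.log (q (g (-s)))) (𝓝[>] 0)
      (𝓝 (Real.log ‖q w‖ + Real.pi * Complex.I)) := by
    refine (Complex.tendsto_log_nhdsWithin_im_nonneg_of_re_neg_of_im_zero hqre hqim).comp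
      (tendsto_nhdsWithin_iff.2 ⟨hqc.tendsto.comp h2, ?_⟩)
    filter_upwards [hI] with s hs
    have := hneg s hs
    change 0 ≤ (q (g (-s))).im
    rw [hq, im_ofReal_sub_div]
    exact (div_pos (mul_pos_of_neg_of_neg this (by linarith)) (hnsq _ this.ne)).le
  have hW1 : Tendsto (fun s => closedArcIndex γ γ' a b (g s)) (𝓝[>] 0) _ :=
    ((hint.comp h1).add hlog1).congr fun s => by simp [closedArcIndex, hq, ha, hb]
  have hW2 : Tendsto (fun s => closedArcIndex γ γ' a b (g (-s))) (𝓝[>] 0) _ :=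
    ((hint.comp h2).add hlog2).congr fun s => by simp [closedArcIndex, hq, ha, hb]
  have e1 := tendsto_nhds_unique (tendsto_const_nhds.congr' (by
    filter_upwards [hI] with s hs using (hα s hs).symm)) hW1
  have e2 := tendsto_nhds_unique (tendsto_const_nhds.congr' (by
    filter_upwards [hI] with s hs using (hβ s hs).symm)) hW2
  intro hαβ
  rw [e1, e2] at hαβ
  have h3 := congrArg Complex.im hαβ
  simp at h3
  linarith [Real.pi_pos]

end Winding

/-! ### Transversal segments and monotonicity of crossings. -/

section Transversal

variable {U : Set ℂ} {f : ℂ → ℂ} {Φ : ℝ → ℂ → ℂ}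

/-- The segment `[-ε, ε]` of the real axis. -/
def realSegment (ε : ℝ) : Set ℂ := {x | x.im = 0 ∧ |x.re| ≤ ε}

lemma isClosed_realSegment (ε : ℝ) : IsClosed (realSegment ε) :=
  (isClosed_eq Complex.continuous_im continuous_const).inter
    (isClosed_le Complex.continuous_re.abs continuous_const)

lemma ofReal_mem_realSegment {ε u : ℝ} : (u : ℂ) ∈ realSegment ε ↔ |u| ≤ ε := by
  simp [realSegment]

lemma exists_ofReal_eq_of_mem_realSegment {ε : ℝ} {x : ℂ} (hx : x ∈ realSegment ε) :
    ∃ u : ℝ, |u| ≤ ε ∧ x = u :=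
  ⟨x.re, hx.2, Complex.ext rfl hx.1⟩

/-- Near a point where the vector field is `I`, trajectories cross the real axis upwards. -/
lemma IsUniqueSolutionMap.exists_transversal (h : IsUniqueSolutionMap U f Φ) (hU : IsOpen U)
    (hf : ContinuousOn f U) (h0 : (0 : ℂ) ∈ U) (hf0 : f 0 = Complex.I) :
    ∃ ε > 0, ∃ δ > 0, (∀ x : ℂ, ‖x‖ ≤ ε → x ∈ U) ∧
      (∀ u : ℝ, |u| ≤ ε → ∀ s ∈ Set.Ioc 0 δ, 0 < (Φ s u).im ∧ (Φ (-s) u).im < 0) ∧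
      ∀ x : ℂ, ‖x‖ ≤ ε → ∃ s, |s| ≤ 2 * |x.im| ∧ (Φ s x).im = 0 ∧
        ‖Φ s x - x‖ ≤ 4 * |x.im| := by
  have hfc : ContinuousAt f 0 := hf.continuousAt (hU.mem_nhds h0)
  have hev : ∀ᶠ x in 𝓝 (0 : ℂ), x ∈ U ∧ ‖f x‖ < 2 ∧ 1 / 2 ≤ (f x).im := by
    refine (show ∀ᶠ x in 𝓝 (0 : ℂ), x ∈ U from hU.mem_nhds h0).and ((hfc.norm.eventually
      (gt_mem_nhds (by simp [hf0]))).and ?_)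
    exact (Complex.continuous_im.continuousAt.comp hfc).eventually
      (le_mem_nhds (by rw [Function.comp, hf0, Complex.I_im]; norm_num))
  -- Starting within `r / 8`, for times up to `r / 4`, a trajectory moves at most `r / 2` and stays
  -- in the ball. Its height grows at rate at least `1 / 2`, so it meets the axis within time `2 *
  -- |x.im|`, having moved at most twice that.
  obtain ⟨r, hr, hball⟩ := Metric.nhds_basis_closedBall.mem_iff.1 hev
  have hxU : ∀ x : ℂ, ‖x‖ ≤ r / 8 → x ∈ U := fun x hx =>
    (hball (by rw [mem_closedBall_zero_iff]; linarith)).1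
  have hmove : ∀ x : ℂ, ‖x‖ ≤ r / 8 → ∀ s, |s| ≤ r / 4 → ‖Φ s x - x‖ ≤ 2 * |s| := by
    intro x hx s hs
    refine h.norm_sub_le (hxU x hx) (ρ := r / 2) (fun p hp => (hball ?_).2.1) (by norm_num)
      (by linarith)
    rw [mem_closedBall_zero_iff]
    rw [Metric.mem_closedBall, dist_eq_norm] at hp
    have := norm_le_norm_add_norm_sub' p x
    linarith
  have hmem : ∀ x : ℂ, ‖x‖ ≤ r / 8 → ∀ s, |s| ≤ r / 4 → Φ s x ∈ Metric.closedBall 0 r := by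
    intro x hx s hs
    rw [mem_closedBall_zero_iff]
    have := norm_le_norm_add_norm_sub' (Φ s x) x
    linarith [hmove x hx s hs]
  have him : ∀ x : ℂ, ‖x‖ ≤ r / 8 → ∀ s s', -(r / 4) ≤ s → s ≤ s' → s' ≤ r / 4 →
      1 / 2 * (s' - s) ≤ (Φ s' x).im - (Φ s x).im := by
    intro x hx s s' hs hss hs'
    have hd : ∀ t, HasDerivAt (fun t => (Φ t x).im) (f (Φ t x)).im t := fun t =>
      Complex.imCLM.hasFDerivAt.comp_hasDerivAt t (h.hasDerivAt (hxU x hx) t)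
    refine (convex_Icc (-(r / 4)) (r / 4)).mul_sub_le_image_sub_of_le_deriv
      (f := fun t => (Φ t x).im) (fun t _ => (hd t).continuousAt.continuousWithinAt)
      (fun t _ => (hd t).differentiableAt.differentiableWithinAt) (fun t ht => ?_)
      s ⟨hs, hss.trans hs'⟩ s' ⟨hs.trans hss, hs'⟩ hss
    rw [(hd t).deriv]
    exact (hball (hmem x hx t (abs_le.2 (interior_subset (s := Set.Icc _ _) ht)))).2.2
  refine ⟨r / 8, by positivity, r / 4, by positivity, hxU, ?_, ?_⟩
  · intro u hu s hs
    have hu' : ‖(u : ℂ)‖ ≤ r / 8 := by simpa using hu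
    have h1 := him u hu' 0 s (by linarith) hs.1.le hs.2
    have h2 := him u hu' (-s) 0 (by linarith [hs.2]) (by linarith [hs.1]) (by linarith)
    rw [h.map_zero (hxU u hu'), Complex.ofReal_im] at h1 h2
    constructor <;> linarith [hs.1]
  · intro x hx
    have hxim : |x.im| ≤ r / 8 := (Complex.abs_im_le_norm x).trans hx
    have hcont : Continuous fun s => (Φ s x).im :=
      Complex.continuous_im.comp (h.continuous_trajectory (hxU x hx))
    obtain ⟨s, hs, hs0⟩ : ∃ s, |s| ≤ 2 * |x.im| ∧ (Φ s x).im = 0 := by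
      rcases le_total 0 x.im with hpos | hneg
      · rw [abs_of_nonneg hpos] at hxim ⊢
        have h1 := him x hx (-(2 * x.im)) 0 (by linarith) (by linarith) (by linarith)
        rw [h.map_zero (hxU x hx)] at h1
        obtain ⟨s, hs, hs0⟩ := intermediate_value_Icc (a := -(2 * x.im)) (b := 0) (by linarith)
          hcont.continuousOn (show (0 : ℝ) ∈ _ from
            ⟨by linarith, by rw [h.map_zero (hxU x hx)]; exact hpos⟩)
        exact ⟨s, abs_le.2 ⟨hs.1, hs.2.trans (by linarith)⟩, hs0⟩
      · rw [abs_of_nonpos hneg] at hxim ⊢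
        have h1 := him x hx 0 (2 * -x.im) (by linarith) (by linarith) (by linarith)
        rw [h.map_zero (hxU x hx)] at h1
        obtain ⟨s, hs, hs0⟩ := intermediate_value_Icc (a := 0) (b := 2 * -x.im) (by linarith)
          hcont.continuousOn (show (0 : ℝ) ∈ _ from
            ⟨by rw [h.map_zero (hxU x hx)]; exact hneg, by linarith⟩)
        exact ⟨s, abs_le.2 ⟨by linarith [hs.1], hs.2⟩, hs0⟩
    exact ⟨s, hs, hs0, by linarith [hmove x hx s (by linarith)]⟩

variable {ε δ : ℝ}

/-- Crossing times are isolated, with the uniform gap `δ`; this makes first and last crossings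
available. -/
lemma IsUniqueSolutionMap.not_mem_realSegment_of_close (h : IsUniqueSolutionMap U f Φ)
    (hcross : ∀ u : ℝ, |u| ≤ ε → ∀ s ∈ Set.Ioc 0 δ, 0 < (Φ s u).im ∧ (Φ (-s) u).im < 0)
    {y : ℂ} (hy : y ∈ U) {s t : ℝ} (ht : Φ t y ∈ realSegment ε) (hst : s ≠ t)
    (hδ : |s - t| ≤ δ) : Φ s y ∉ realSegment ε := by
  obtain ⟨u, hu, hux⟩ := exists_ofReal_eq_of_mem_realSegment ht
  intro hs
  have hΦ : Φ s y = Φ (s - t) u := by rw [← hux, ← h.map_add hy, sub_add_cancel]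
  have him := hs.1
  rw [hΦ] at him
  rcases lt_or_gt_of_ne hst with hlt | hlt
  · rw [abs_of_neg (sub_neg.2 hlt)] at hδ
    have := (hcross u hu (-(s - t)) ⟨by linarith, hδ⟩).2
    rw [neg_neg] at this
    exact this.ne him
  · rw [abs_of_pos (sub_pos.2 hlt)] at hδ
    exact (hcross u hu (s - t) ⟨by linarith, hδ⟩).1.ne' him

/-- After two consecutive crossings of a transversal segment, all later crossings lie beyond the
second one. -/
lemma IsUniqueSolutionMap.crossing_lt (h : IsUniqueSolutionMap U f Φ) (hU : IsOpen U)
    (hf : ContinuousOn f U) (hεU : ∀ x : ℂ, ‖x‖ ≤ ε → x ∈ U) (hδ : 0 < δ)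
    (hcross : ∀ u : ℝ, |u| ≤ ε → ∀ s ∈ Set.Ioc 0 δ, 0 < (Φ s u).im ∧ (Φ (-s) u).im < 0)
    {y : ℂ} (hy : y ∈ U) (hinj : Function.Injective fun t => Φ t y) {a b c : ℝ} (hab : a < b)
    (hbc : b < c) (ha : Φ a y ∈ realSegment ε) (hb : Φ b y ∈ realSegment ε)
    (hc : Φ c y ∈ realSegment ε) (hlt : (Φ a y).re < (Φ b y).re)
    (hab' : ∀ t ∈ Set.Ioo a b, Φ t y ∉ realSegment ε) : (Φ b y).re < (Φ c y).re := by
  by_contra! hcon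
  obtain ⟨u, hu, hua⟩ := exists_ofReal_eq_of_mem_realSegment ha
  obtain ⟨v, hv, hvb⟩ := exists_ofReal_eq_of_mem_realSegment hb
  have huv : u < v := by simpa [hua, hvb] using hlt
  have hγ : ∀ t, HasDerivAt (fun t => Φ t y) (f (Φ t y)) t := h.hasDerivAt hy
  have hγc := h.continuous_trajectory hy
  have hγ' : Continuous fun t => f (Φ t y) := hf.comp_continuous hγc fun t => h.mem hy t
  have hwU : ∀ w : ℝ, |w| ≤ ε → (w : ℂ) ∈ U := fun w hw => hεU w (by simpa using hw)
  have hsegim : ∀ x : ℂ, x.im ≠ 0 → ∀ w ∈ Set.Icc u v, (w : ℂ) ≠ x := by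
    rintro _ hx w - rfl
    exact hx (Complex.ofReal_im w)
  -- crossing times near `[a, b]`
  have htimes : ∀ t, a - δ ≤ t → t ≤ b + δ → Φ t y ∈ realSegment ε → t = a ∨ t = b := by
    intro t h1 h2 ht
    by_contra! hne
    rcases lt_or_gt_of_ne hne.1 with hta | hta
    · exact h.not_mem_realSegment_of_close hcross hy ha hne.1
        (by rw [abs_of_neg (sub_neg.2 hta)]; linarith) ht
    · rcases lt_or_gt_of_ne hne.2 with htb | htb
      · exact hab' t ⟨hta, htb⟩ ht
      · exact h.not_mem_realSegment_of_close hcross hy hb hne.2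
          (by rw [abs_of_pos (sub_pos.2 htb)]; linarith) ht
  have hoff : ∀ w : ℝ, |w| ≤ ε → ∀ s, ∀ t ∈ Set.Icc a b, Φ t y = Φ s w → Φ (t - s) y = w := by
    intro w hw s t ht heq
    rw [sub_eq_neg_add, h.map_add hy, heq, ← h.map_add (hwU w hw), neg_add_cancel,
      h.map_zero (hwU w hw)]
  have hoffp : ∀ w : ℝ, |w| ≤ ε → w ≠ u → ∀ s ∈ Set.Ioc 0 δ, ∀ t ∈ Set.Icc a b,
      Φ t y ≠ Φ s w := by
    intro w hw hwu s hs t ht heq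
    have h1 := hoff w hw s t ht heq
    rcases htimes (t - s) (by linarith [ht.1, hs.2]) (by linarith [ht.2, hs.1])
      (h1 ▸ ofReal_mem_realSegment.2 hw) with h2 | h2
    · rw [h2, hua] at h1
      exact hwu (by exact_mod_cast h1.symm)
    · linarith [ht.2, hs.1]
  have hoffn : ∀ w : ℝ, |w| ≤ ε → w ≠ v → ∀ s ∈ Set.Ioc 0 δ, ∀ t ∈ Set.Icc a b,
      Φ t y ≠ Φ (-s) w := by
    intro w hw hwv s hs t ht heq
    have h1 := hoff w hw (-s) t ht heq
    rcases htimes (t - -s) (by linarith [ht.1, hs.1]) (by linarith [ht.2, hs.2])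
      (h1 ▸ ofReal_mem_realSegment.2 hw) with h2 | h2
    · linarith [ht.1, hs.1]
    · rw [h2, hvb] at h1
      exact hwv (by exact_mod_cast h1.symm)
  set W := closedArcIndex (fun t => Φ t y) (fun t => f (Φ t y)) a b with hW
  have hcontΦ : ∀ S : Set (ℝ × ℝ), (∀ p ∈ S, |p.2| ≤ ε) →
      ContinuousOn (fun p : ℝ × ℝ => Φ p.1 p.2) S := by
    intro S hS p hp
    refine ContinuousAt.continuousWithinAt ?_
    exact ContinuousAt.comp (f := fun p : ℝ × ℝ => (p.1, (p.2 : ℂ)))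
      (g := fun p : ℝ × ℂ => Φ p.1 p.2) (h.continuousAt hU hf (hwU _ (hS p hp)) p.1)
      (by fun_prop)
  -- The strip swept just above the segment to the right of `u` meets the arc nowhere: flowing a
  -- common point back would give a crossing at time `a`, hence `w = u`. It contains the trajectory
  -- just after `b`.
  have hWp : ∀ s ∈ Set.Ioc 0 δ, ∀ w ∈ Set.Ioc u ε, W (Φ s w) = W (Φ δ v) := by
    intro s hs w hw
    have hwε : ∀ w ∈ Set.Ioc u ε, |w| ≤ ε := fun w hw =>
      abs_le.2 ⟨(abs_le.1 hu).1.trans hw.1.le, hw.2⟩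
    have hpre : IsPreconnected ((fun p : ℝ × ℝ => Φ p.1 p.2) '' (Set.Ioc 0 δ ×ˢ Set.Ioc u ε)) :=
      (isPreconnected_Ioc.prod isPreconnected_Ioc).image _
        (hcontΦ _ fun p hp => hwε p.2 hp.2)
    refine closedArcIndex_eq_of_isPreconnected hγ hγ' hab.le hua hvb huv hpre ?_ ?_
      ⟨(s, w), ⟨hs, hw⟩, rfl⟩ ⟨(δ, v), ⟨⟨hδ, le_rfl⟩, huv, (abs_le.1 hv).2⟩, rfl⟩
    · rintro _ ⟨p, hp, rfl⟩
      exact hoffp p.2 (hwε _ hp.2) hp.2.1.ne' p.1 hp.1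
    · rintro _ ⟨p, hp, rfl⟩
      exact hsegim _ (hcross p.2 (hwε _ hp.2) p.1 hp.1).1.ne'
  -- Likewise below the segment to the left of `v`; any later crossing there must come through this
  -- strip.
  have hWn : ∀ s ∈ Set.Ioc 0 δ, ∀ w ∈ Set.Ico (-ε) v, W (Φ (-s) w) = W (Φ (-δ) u) := by
    intro s hs w hw
    have hwε : ∀ w ∈ Set.Ico (-ε) v, |w| ≤ ε := fun w hw =>
      abs_le.2 ⟨hw.1, hw.2.le.trans (abs_le.1 hv).2⟩
    have hpre : IsPreconnected ((fun p : ℝ × ℝ => Φ p.1 p.2) ''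
        (Set.Ico (-δ) 0 ×ˢ Set.Ico (-ε) v)) :=
      (isPreconnected_Ico.prod isPreconnected_Ico).image _
        (hcontΦ _ fun p hp => hwε p.2 hp.2)
    refine closedArcIndex_eq_of_isPreconnected hγ hγ' hab.le hua hvb huv hpre ?_ ?_
      ⟨(-s, w), ⟨⟨neg_le_neg hs.2, neg_lt_zero.2 hs.1⟩, hw⟩, rfl⟩
      ⟨(-δ, u), ⟨⟨le_rfl, neg_lt_zero.2 hδ⟩, (abs_le.1 hu).1, huv⟩, rfl⟩
    · rintro _ ⟨p, hp, rfl⟩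
      have := hoffn p.2 (hwε _ hp.2) hp.2.2.ne (-p.1)
        ⟨neg_pos.2 hp.1.2, neg_le.1 hp.1.1⟩
      rwa [neg_neg] at this
    · rintro _ ⟨p, hp, rfl⟩
      have := (hcross p.2 (hwε _ hp.2) (-p.1) ⟨neg_pos.2 hp.1.2, neg_le.1 hp.1.1⟩).2
      rw [neg_neg] at this
      exact hsegim _ this.ne
  have hne : W (Φ δ v) ≠ W (Φ (-δ) u) := by
    obtain ⟨w, hw1, hw2⟩ := exists_between huv
    have hw : |w| ≤ ε :=
      abs_le.2 ⟨(abs_le.1 hu).1.trans hw1.le, hw2.le.trans (abs_le.1 hv).2⟩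
    refine closedArcIndex_jump hγc hγ' hab.le hua hvb hw1 hw2 ?_ (g := fun s => Φ s w)
      (h.continuous_trajectory (hwU w hw)).continuousAt (h.map_zero (hwU w hw)) hδ
      (fun s hs => (hcross w hw s hs).1) (fun s hs => (hcross w hw s hs).2)
      (fun s hs => hWp s hs w ⟨hw1, hw2.le.trans (abs_le.1 hv).2⟩)
      (fun s hs => hWn s hs w ⟨(abs_le.1 hu).1.trans hw1.le, hw2⟩)
    intro t ht heq
    rcases htimes t (by linarith [ht.1]) (by linarith [ht.2])
      (heq ▸ ofReal_mem_realSegment.2 hw) with rfl | rfl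
    · exact hw1.ne' (by exact_mod_cast heq.symm.trans hua)
    · exact hw2.ne (by exact_mod_cast heq.symm.trans hvb)
  -- the first return to the part of the segment up to `v`
  have hclosed : IsClosed {t | Φ t y ∈ realSegment ε ∧ (Φ t y).re ≤ v} :=
    ((isClosed_realSegment ε).preimage hγc).inter
      (isClosed_le (Complex.continuous_re.comp hγc) continuous_const)
  have hcv : (Φ c y).re ≤ v := by simpa [hvb] using hcon
  have hsep : ∀ t, b < t → Φ t y ∈ realSegment ε → b + δ < t := by
    intro t hbt ht
    by_contra! hle
    rcases htimes t (by linarith) hle ht with rfl | rfl <;> linarith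
  obtain ⟨d, ⟨⟨hd, hdv⟩, hdI⟩, hdmin⟩ :=
    (isCompact_Icc.inter_left hclosed).exists_isLeast
      (s := {t | Φ t y ∈ realSegment ε ∧ (Φ t y).re ≤ v} ∩ Set.Icc (b + δ) c)
      ⟨c, ⟨hc, hcv⟩, (hsep c hbc hc).le, le_rfl⟩
  have hbd : b < d := by linarith [hdI.1]
  have hbd' := hsep d hbd hd
  obtain ⟨w, hw, hwd⟩ := exists_ofReal_eq_of_mem_realSegment hd
  have hwv : w < v := by
    refine lt_of_le_of_ne (by simpa [hwd] using hdv) fun hwv => ?_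
    have : Φ d y = Φ b y := by rw [hwd, hvb, hwv]
    exact hbd.ne' (hinj this)
  have hpre : IsPreconnected ((fun t => Φ t y) '' Set.Ioo b d) :=
    isPreconnected_Ioo.image _ hγc.continuousOn
  have hWd : ∀ s ∈ Set.Ioo b d, ∀ t ∈ Set.Ioo b d, W (Φ s y) = W (Φ t y) := by
    intro s hs t ht
    refine closedArcIndex_eq_of_isPreconnected hγ hγ' hab.le hua hvb huv hpre ?_ ?_
      ⟨s, hs, rfl⟩ ⟨t, ht, rfl⟩
    · rintro _ ⟨r, hr, rfl⟩ t ht heq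
      have := hinj heq
      linarith [hr.1, ht.2]
    · rintro _ ⟨r, hr, rfl⟩ q hq heq
      change (q : ℂ) = Φ r y at heq
      have hqε : |q| ≤ ε :=
        abs_le.2 ⟨(abs_le.1 hu).1.trans hq.1, hq.2.trans (abs_le.1 hv).2⟩
      have hr' : Φ r y ∈ realSegment ε := heq ▸ ofReal_mem_realSegment.2 hqε
      have := hdmin ⟨⟨hr', by rw [← heq]; simpa using hq.2⟩, (hsep r hr.1 hr').le,
        hr.2.le.trans hdI.2⟩
      linarith [hr.2]
  -- Between `b` and `d` the trajectory avoids the closed curve but joins the upper strip to the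
  -- lower one, which have different indices.
  apply hne
  have e1 : Φ δ v = Φ (δ + b) y := by rw [← hvb, h.map_add hy]
  have e2 : Φ (-δ) w = Φ (-δ + d) y := by rw [← hwd, h.map_add hy]
  rw [← hWn δ ⟨hδ, le_rfl⟩ w ⟨(abs_le.1 hw).1, hwv⟩, e1, e2]
  exact hWd _ ⟨by linarith, by linarith⟩ _ ⟨by linarith, by linarith⟩

/-- Applying `Φ s` merely shifts time along the trajectory, so limit sets are invariant in both time
directions. -/
lemma IsUniqueSolutionMap.mapClusterPt_map {E : Type*} [NormedAddCommGroup E] [NormedSpace ℝ E]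
    [ProperSpace E] {U : Set E} {f : E → E} {Φ : ℝ → E → E} (h : IsUniqueSolutionMap U f Φ)
    (hU : IsOpen U) (hf : ContinuousOn f U) {x y : E} (hx : x ∈ U) (hy : y ∈ U)
    (hxy : MapClusterPt x atTop fun t => Φ t y) (s : ℝ) :
    MapClusterPt (Φ s x) atTop fun t => Φ t y := by
  have h1 := hxy.continuousAt_comp (h.continuousAt_map hU hf hx s)
  have h2 : Φ s ∘ (fun t => Φ t y) = (fun t => Φ t y) ∘ fun t => s + t := by
    funext t
    exact (h.map_add hy s t).symm
  rw [h2] at h1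
  exact h1.of_comp (tendsto_atTop_add_const_left _ s tendsto_id)

/-- A trajectory that accumulates at a point of the transversal crosses it near that point. -/
lemma IsUniqueSolutionMap.exists_crossing_near (h : IsUniqueSolutionMap U f Φ)
    (hsect : ∀ x : ℂ, ‖x‖ ≤ ε → ∃ s, |s| ≤ 2 * |x.im| ∧ (Φ s x).im = 0 ∧
      ‖Φ s x - x‖ ≤ 4 * |x.im|)
    {y : ℂ} (hy : y ∈ U) {w : ℝ} (hw : |w| < ε) (hwy : MapClusterPt (w : ℂ) atTop fun t => Φ t y)
    {κ : ℝ} (hκ : 0 < κ) (T : ℝ) :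
    ∃ t > T, Φ t y ∈ realSegment ε ∧ |(Φ t y).re - w| < κ := by
  -- A point within `η` of `w` moves at most `4 * η` to reach the axis, ending within `5 * η`; the
  -- time change is at most `2 * η ≤ 1`, absorbed by starting after `T + 1`.
  obtain ⟨η, hη, hη1, hη2, hη3⟩ : ∃ η > 0, 5 * η ≤ κ ∧ 5 * η ≤ ε - |w| ∧ 2 * η ≤ 1 := by
    refine ⟨min (κ / 5) (min ((ε - |w|) / 5) (1 / 2)), ?_, ?_, ?_, ?_⟩
    · have := sub_pos.2 hw
      positivity
    · linarith [min_le_left (κ / 5) (min ((ε - |w|) / 5) (1 / 2))]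
    · linarith [min_le_right (κ / 5) (min ((ε - |w|) / 5) (1 / 2)),
        min_le_left ((ε - |w|) / 5) (1 / 2)]
    · linarith [min_le_right (κ / 5) (min ((ε - |w|) / 5) (1 / 2)),
        min_le_right ((ε - |w|) / 5) (1 / 2)]
  obtain ⟨t, htw, htT⟩ := ((hwy.frequently (Metric.ball_mem_nhds (w : ℂ) hη)).and_eventually
    (eventually_gt_atTop (T + 1))).exists
  rw [dist_eq_norm] at htw
  have him : |(Φ t y).im| ≤ ‖Φ t y - w‖ := by simpa using Complex.abs_im_le_norm (Φ t y - w)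
  have hnorm : ‖Φ t y‖ ≤ |w| + ‖Φ t y - w‖ := by
    simpa using norm_le_norm_add_norm_sub' (Φ t y) w
  obtain ⟨s, hs, hs0, hsx⟩ := hsect (Φ t y) (by linarith)
  rw [← h.map_add hy] at hs0 hsx
  have hre : |(Φ (s + t) y).re - w| ≤ 5 * ‖Φ t y - w‖ := by
    have h1 : |(Φ (s + t) y).re - w| ≤ ‖Φ (s + t) y - w‖ := by
      simpa using Complex.abs_re_le_norm (Φ (s + t) y - w)
    have h2 := norm_sub_le_norm_sub_add_norm_sub (Φ (s + t) y) (Φ t y) (w : ℂ)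
    linarith
  refine ⟨s + t, by linarith [neg_le_of_abs_le hs], ⟨hs0, ?_⟩, by linarith⟩
  have := abs_sub_abs_le_abs_sub (Φ (s + t) y).re w
  linarith

/-- The limit set of a trajectory that is not periodic meets a transversal in at most one point. -/
lemma IsUniqueSolutionMap.not_lt_of_mapClusterPt (h : IsUniqueSolutionMap U f Φ) (hU : IsOpen U)
    (hf : ContinuousOn f U) (hεU : ∀ x : ℂ, ‖x‖ ≤ ε → x ∈ U) (hδ : 0 < δ)
    (hcross : ∀ u : ℝ, |u| ≤ ε → ∀ s ∈ Set.Ioc 0 δ, 0 < (Φ s u).im ∧ (Φ (-s) u).im < 0)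
    (hsect : ∀ x : ℂ, ‖x‖ ≤ ε → ∃ s, |s| ≤ 2 * |x.im| ∧ (Φ s x).im = 0 ∧
      ‖Φ s x - x‖ ≤ 4 * |x.im|)
    {y : ℂ} (hy : y ∈ U) (hinj : Function.Injective fun t => Φ t y) {w w' : ℝ}
    (hw : |w| < ε) (hw' : |w'| < ε) (hwy : MapClusterPt (w : ℂ) atTop fun t => Φ t y)
    (hwy' : MapClusterPt (w' : ℂ) atTop fun t => Φ t y) : ¬ w < w' := by
  intro hlt
  have hγc := h.continuous_trajectory hy
  have hκ : 0 < (w' - w) / 2 := by linarith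
  obtain ⟨a₀, -, ha₀, ha₀w⟩ := h.exists_crossing_near hsect hy hw hwy hκ 0
  obtain ⟨b₀, hab₀, hb₀, hb₀w⟩ := h.exists_crossing_near hsect hy hw' hwy' hκ a₀
  obtain ⟨c, hbc, hc, hcw⟩ := h.exists_crossing_near hsect hy hw hwy hκ b₀
  rw [abs_lt] at ha₀w hb₀w hcw
  -- Let `b` be the first crossing from `a₀` on at or beyond the midpoint, and `a` the crossing just
  -- before `b`. This pair is increasing, so the later crossing `c` near `w` is impossible.
  set m := (w + w') / 2 with hm
  have hSc : IsClosed {t | Φ t y ∈ realSegment ε} := (isClosed_realSegment ε).preimage hγc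
  obtain ⟨b, ⟨⟨hb, hbm⟩, hbI⟩, hbmin⟩ :=
    (isCompact_Icc.inter_left (hSc.inter (isClosed_le (continuous_const (y := m))
      (Complex.continuous_re.comp hγc)))).exists_isLeast
      (s := {t | Φ t y ∈ realSegment ε} ∩ {t | m ≤ (Φ t y).re} ∩ Set.Icc a₀ b₀)
      ⟨b₀, ⟨hb₀, by change m ≤ _; linarith⟩, hab₀.le, le_rfl⟩
  change Φ b y ∈ realSegment ε at hb
  change m ≤ (Φ b y).re at hbm
  have hab : a₀ < b := lt_of_le_of_ne hbI.1 fun heq => by rw [← heq] at hbm; linarith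
  have hsep : ∀ t < b, Φ t y ∈ realSegment ε → t ≤ b - δ := by
    intro t htb ht
    by_contra! hle
    exact h.not_mem_realSegment_of_close hcross hy hb htb.ne
      (by rw [abs_of_neg (sub_neg.2 htb)]; linarith) ht
  obtain ⟨a, ⟨ha, haI⟩, hamax⟩ :=
    (isCompact_Icc.inter_left hSc).exists_isGreatest
      (s := {t | Φ t y ∈ realSegment ε} ∩ Set.Icc a₀ (b - δ))
      ⟨a₀, ha₀, le_rfl, hsep a₀ hab ha₀⟩
  have hab' : a < b := by linarith [haI.2]
  have ham : (Φ a y).re < m := by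
    by_contra! hle
    linarith [hbmin ⟨⟨ha, hle⟩, haI.1, hab'.le.trans hbI.2⟩]
  have := h.crossing_lt hU hf hεU hδ hcross hy hinj hab' (hbI.2.trans_lt hbc) ha hb hc
    (by linarith) fun t ht hts => by
      linarith [hamax ⟨hts, haI.1.trans ht.1.le, hsep t ht.2 hts⟩, ht.1]
  linarith

/-- Near a point where the vector field is `I`, the limit set of a trajectory that is not periodic
is contained in a single short orbit arc. -/
lemma IsUniqueSolutionMap.exists_nhds_limit_arc_of_eq_I (h : IsUniqueSolutionMap U f Φ)
    (hU : IsOpen U) (hf : ContinuousOn f U) (h0 : (0 : ℂ) ∈ U) (hf0 : f 0 = Complex.I) :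
    ∃ N ∈ 𝓝 (0 : ℂ), ∀ y ∈ U, (Function.Injective fun t => Φ t y) → ∀ x ∈ N, ∀ x' ∈ N,
      MapClusterPt x atTop (fun t => Φ t y) → MapClusterPt x' atTop (fun t => Φ t y) →
      ∃ s, |s| ≤ 1 ∧ Φ s x = x' := by
  obtain ⟨ε, hε, δ, hδ, hεU, hcross, hsect⟩ := h.exists_transversal hU hf h0 hf0
  -- Projecting to the axis along the flow multiplies the norm by at most `5` and takes time at most
  -- `1 / 2`; two projections cost at most `1`.
  refine ⟨Metric.ball 0 (min (ε / 5) (1 / 4)), Metric.ball_mem_nhds _ (by positivity), ?_⟩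
  intro y hy hinj
  have key : ∀ x ∈ Metric.ball (0 : ℂ) (min (ε / 5) (1 / 4)),
      MapClusterPt x atTop (fun t => Φ t y) → x ∈ U ∧ ∃ s, |s| ≤ 1 / 2 ∧ ∃ w : ℝ, |w| < ε ∧
        Φ s x = w ∧ MapClusterPt (w : ℂ) atTop fun t => Φ t y := by
    intro x hx hxy
    rw [mem_ball_zero_iff, lt_min_iff] at hx
    have hxU : x ∈ U := hεU x (by linarith)
    obtain ⟨s, hs, hs0, hsx⟩ := hsect x (by linarith)
    have him := Complex.abs_im_le_norm x
    have heq : Φ s x = ((Φ s x).re : ℂ) := Complex.ext rfl hs0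
    refine ⟨hxU, s, by linarith, (Φ s x).re, ?_, heq, ?_⟩
    · have h1 := Complex.abs_re_le_norm (Φ s x)
      have h2 := norm_le_norm_add_norm_sub' (Φ s x) x
      linarith
    · rw [← heq]
      exact h.mapClusterPt_map hU hf hxU hy hxy s
  intro x hx x' hx' hxy hxy'
  obtain ⟨hxU, s, hs, w, hw, hsw, hwy⟩ := key x hx hxy
  obtain ⟨hxU', s', hs', w', hw', hsw', hwy'⟩ := key x' hx' hxy'
  have hww : w = w' := le_antisymm
    (not_lt.1 (h.not_lt_of_mapClusterPt hU hf hεU hδ hcross hsect hy hinj hw' hw hwy' hwy))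
    (not_lt.1 (h.not_lt_of_mapClusterPt hU hf hεU hδ hcross hsect hy hinj hw hw' hwy hwy'))
  refine ⟨-s' + s, ?_, ?_⟩
  · rw [abs_le] at *
    constructor <;> linarith
  · rw [h.map_add hxU, hsw, hww, ← hsw', ← h.map_add hxU', neg_add_cancel, h.map_zero hxU']

end Transversal

/-! ### The Poincaré–Bendixson trichotomy. -/

section PoincareBendixson

/-- Solution maps are transported by affine isomorphisms. -/
lemma IsUniqueSolutionMap.conj {E F : Type*} [NormedAddCommGroup E] [NormedSpace ℝ E]
    [NormedAddCommGroup F] [NormedSpace ℝ F] {U : Set E} {f : E → E} {Φ : ℝ → E → E}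
    (h : IsUniqueSolutionMap U f Φ) (e : E ≃L[ℝ] F) (z : E) :
    IsUniqueSolutionMap {w | e.symm w + z ∈ U} (fun w => e (f (e.symm w + z)))
      (fun t w => e (Φ t (e.symm w + z) - z)) := by
  intro w hw
  refine ⟨⟨⟨fun t => ?_, fun t => ?_⟩, ?_⟩, ?_⟩
  · simpa using h.mem hw t
  · have := e.toContinuousLinearMap.hasFDerivAt.comp_hasDerivAt t
      ((h.hasDerivAt hw t).sub_const z)
    simpa [Function.comp_def] using this
  · simp [h.map_zero hw]
  · intro γ hγ h0
    have hsol : IsGlobalSolution U f (fun t => e.symm (γ t) + z) := by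
      refine ⟨fun t => hγ.1 t, fun t => ?_⟩
      have := (e.symm.toContinuousLinearMap.hasFDerivAt.comp_hasDerivAt t (hγ.2 t)).add_const z
      simpa [Function.comp_def] using this
    funext t
    have := h.eq_of_solution hw hsol (by rw [h0]) t
    simp [← this]

lemma exists_complex_coordinate {v : EuclideanSpace ℝ (Fin 2)} (hv : v ≠ 0) :
    ∃ e : EuclideanSpace ℝ (Fin 2) ≃L[ℝ] ℂ, e v = Complex.I := by
  set e₀ := Complex.orthonormalBasisOneI.repr.symm
  have hc : e₀ v ≠ 0 := by simpa using hv
  have hc' : Complex.I / e₀ v ≠ 0 := div_ne_zero Complex.I_ne_zero hc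
  refine ⟨e₀.toContinuousLinearEquiv.trans
    ((LinearEquiv.smulOfNeZero ℂ ℂ _ hc').restrictScalars ℝ).toContinuousLinearEquiv, ?_⟩
  simp [hc]

variable {U : Set (EuclideanSpace ℝ (Fin 2))}
  {f : EuclideanSpace ℝ (Fin 2) → EuclideanSpace ℝ (Fin 2)}
  {Φ : ℝ → EuclideanSpace ℝ (Fin 2) → EuclideanSpace ℝ (Fin 2)}

/-- Near a point that is not an equilibrium, the limit set of a trajectory that is not periodic
is contained in a single short orbit arc. -/
theorem IsUniqueSolutionMap.exists_nhds_limit_arc (h : IsUniqueSolutionMap U f Φ)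
    (hU : IsOpen U) (hf : ContinuousOn f U) {z : EuclideanSpace ℝ (Fin 2)} (hz : z ∈ U)
    (hfz : f z ≠ 0) :
    ∃ N ∈ 𝓝 z, ∀ y ∈ U, (Function.Injective fun t => Φ t y) → ∀ x ∈ N, ∀ x' ∈ N,
      MapClusterPt x atTop (fun t => Φ t y) → MapClusterPt x' atTop (fun t => Φ t y) →
      ∃ s, |s| ≤ 1 ∧ Φ s x = x' := by
  obtain ⟨e, he⟩ := exists_complex_coordinate hfz
  have hcont : Continuous fun w => e.symm w + z := by fun_prop
  have hA : Continuous fun x => e (x - z) := by fun_prop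
  obtain ⟨N, hN, hNarc⟩ := (h.conj e z).exists_nhds_limit_arc_of_eq_I (hU.preimage hcont)
    (e.continuous.comp_continuousOn (hf.comp hcont.continuousOn fun w hw => hw))
    (by simpa using hz) (by simpa using he)
  refine ⟨(fun x => e (x - z)) ⁻¹' N, hA.continuousAt.preimage_mem_nhds (by simpa using hN), ?_⟩
  intro y hy hinj x hx x' hx' hxy hxy'
  obtain ⟨s, hs, hsx⟩ := hNarc (e (y - z)) (by simpa using hy)
    (fun s t hst => hinj (by simpa using hst)) _ hx _ hx'
    (by simpa [Function.comp_def] using hxy.continuousAt_comp hA.continuousAt)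
    (by simpa [Function.comp_def] using hxy'.continuousAt_comp hA.continuousAt)
  exact ⟨s, hs, by simpa using hsx⟩

/-- If a limit point of a trajectory in a compact set is not an equilibrium and accumulates, in
forward or backward time, at a point that is not an equilibrium, then the limit set is a periodic
orbit. -/
theorem IsUniqueSolutionMap.isPeriodicOrbit_of_mapClusterPt (h : IsUniqueSolutionMap U f Φ)
    (hU : IsOpen U) (hf : ContinuousOn f U) {y₀ : EuclideanSpace ℝ (Fin 2)} (hy₀ : y₀ ∈ U)
    (hinj : Function.Injective fun t => Φ t y₀)
    (hLU : {x | MapClusterPt x atTop fun t => Φ t y₀} ⊆ U)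
    (hLconn : IsConnected {x | MapClusterPt x atTop fun t => Φ t y₀})
    {y z : EuclideanSpace ℝ (Fin 2)} (hy : MapClusterPt y atTop fun t => Φ t y₀) (hfy : f y ≠ 0)
    {F : Filter ℝ} (hF : Tendsto abs F atTop) (hz : MapClusterPt z F fun t => Φ t y)
    (hfz : f z ≠ 0) : IsPeriodicOrbit U f Φ {x | MapClusterPt x atTop fun t => Φ t y₀} := by
  have hyU : y ∈ U := hLU hy
  have hL : ∀ t, MapClusterPt (Φ t y) atTop fun t => Φ t y₀ := fun t =>
    h.mapClusterPt_map hU hf hyU hy₀ hy t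
  have hzL : MapClusterPt z atTop fun t => Φ t y₀ :=
    clusterSet_subset (isClosed_clusterSet (fun t => Φ t y₀) atTop) (Eventually.of_forall hL) hz
  obtain ⟨N, hN, harc⟩ := h.exists_nhds_limit_arc hU hf (hLU hzL) hfz
  have hfr := hz.frequently hN
  obtain ⟨t₁, ht₁⟩ := hfr.exists
  -- The two visits to `N` are more than `1` apart in time, but some arc of duration at most `1`
  -- joins them, so the trajectory repeats a value. Assuming only `|t| → ∞` along `F` covers both
  -- time directions.
  obtain ⟨t₂, ht₂, ht₂'⟩ :=
    (hfr.and_eventually (hF.eventually (eventually_gt_atTop (1 + |t₁|)))).exists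
  obtain ⟨s, hs, hst⟩ := harc y₀ hy₀ hinj _ ht₁ _ ht₂ (hL t₁) (hL t₂)
  have hnot : ¬ Function.Injective fun t => Φ t y := by
    intro hinj'
    rw [← h.map_add hyU] at hst
    have : s + t₁ = t₂ := hinj' hst
    have := abs_add_le s t₁
    rw [‹s + t₁ = t₂›] at this
    linarith
  obtain ⟨T, hT, hper⟩ := h.exists_periodic_of_not_injective hyU hnot
  have hclosed : IsClosed (orbitOf Φ y) :=
    (hper.compact_of_continuous hT.ne' (h.continuous_trajectory hyU)).isClosed
  refine ⟨y, hyU, hfy, ⟨T, hT, hper⟩, Set.Subset.antisymm ?_ ?_⟩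
  -- The orbit is relatively open in the limit set because nearby limit points lie on the same orbit
  -- arc.
  · have hopen : ∀ p ∈ orbitOf Φ y, ∃ O : Set (EuclideanSpace ℝ (Fin 2)), IsOpen O ∧ p ∈ O ∧
        O ∩ {x | MapClusterPt x atTop fun t => Φ t y₀} ⊆ orbitOf Φ y := by
      rintro _ ⟨t, rfl⟩
      obtain ⟨N, hN, harc⟩ := h.exists_nhds_limit_arc hU hf (h.mem hyU t) (h.map_ne_zero hyU hfy t)
      obtain ⟨O, hON, hO, hpO⟩ := mem_nhds_iff.1 hN
      refine ⟨O, hO, hpO, fun x hx => ?_⟩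
      obtain ⟨s, -, hs⟩ := harc y₀ hy₀ hinj _ (hON hpO) x (hON hx.1) (hL t) hx.2
      exact ⟨s + t, by simpa only [h.map_add hyU] using hs⟩
    choose! O hO hpO hOL using hopen
    have hOpen : IsOpen (⋃ p ∈ orbitOf Φ y, O p) := isOpen_biUnion hO
    intro x hx
    by_contra hxo
    obtain ⟨q, hqL, hq, hq'⟩ := hLconn.isPreconnected _ _ hOpen hclosed.isOpen_compl
      (fun p _ => by
        by_cases hp : p ∈ orbitOf Φ y
        · exact Or.inl (Set.mem_biUnion hp (hpO p hp))
        · exact Or.inr hp)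
      ⟨y, hy, Set.mem_biUnion ⟨0, h.map_zero hyU⟩ (hpO y ⟨0, h.map_zero hyU⟩)⟩ ⟨x, hx, hxo⟩
    obtain ⟨p, hp, hqp⟩ := Set.mem_iUnion₂.1 hq
    exact hq' (hOL p hp ⟨hqp, hqL⟩)
  · rintro _ ⟨t, rfl⟩
    exact hL t

/-- The orbit is compact, and each of its points is revisited at the times `t + n * T`. -/
lemma IsUniqueSolutionMap.omegaSet_eq_orbitOf (h : IsUniqueSolutionMap U f Φ)
    {y : EuclideanSpace ℝ (Fin 2)} (hy : y ∈ U) {T : ℝ} (hT : 0 < T)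
    (hper : Function.Periodic (fun t => Φ t y) T) : omegaSet Φ y = orbitOf Φ y := by
  rw [omegaSet, omegaLimit_singleton_eq]
  refine Set.Subset.antisymm (clusterSet_subset
    (hper.compact_of_continuous hT.ne' (h.continuous_trajectory hy)).isClosed
    (Eventually.of_forall fun t => ⟨t, rfl⟩)) ?_
  rintro _ ⟨t, rfl⟩
  have h1 : Tendsto (fun n : ℕ => t + n * T) atTop atTop :=
    tendsto_atTop_add_const_left _ _ (tendsto_natCast_atTop_atTop.atTop_mul_const hT)
  refine MapClusterPt.of_comp h1 (Tendsto.mapClusterPt ?_)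
  refine tendsto_const_nhds.congr fun n => ?_
  exact (hper.nat_mul n t).symm

/-- The Poincaré–Bendixson trichotomy for arbitrary sets of equilibria. -/
theorem IsUniqueSolutionMap.trichotomy (h : IsUniqueSolutionMap U f Φ) (hU : IsOpen U)
    (hf : ContinuousOn f U) {R : Set (EuclideanSpace ℝ (Fin 2))} (hRU : R ⊆ U) (hR : IsCompact R)
    (hinv : IsForwardInvariant Φ R) {y₀ : EuclideanSpace ℝ (Fin 2)} (hy₀ : y₀ ∈ R) :
    ((omegaSet Φ y₀).Nonempty ∧ omegaSet Φ y₀ ⊆ equilibria U f) ∨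
      IsPeriodicOrbit U f Φ (omegaSet Φ y₀) ∨
      ((∃ e ∈ omegaSet Φ y₀, e ∈ equilibria U f) ∧
        (∃ y ∈ omegaSet Φ y₀, OnGeneralizedConnectingOrbit U f Φ y) ∧
        ∀ y ∈ omegaSet Φ y₀, y ∈ equilibria U f ∨ OnGeneralizedConnectingOrbit U f Φ y) := by
  have hyU := hRU hy₀
  have hev : ∀ᶠ t in atTop, Φ t y₀ ∈ R := by
    filter_upwards [eventually_ge_atTop 0] with t ht using hinv ht hy₀
  have hLR : {x | MapClusterPt x atTop fun t => Φ t y₀} ⊆ R := clusterSet_subset hR.isClosed hev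
  have hLc : IsCompact {x | MapClusterPt x atTop fun t => Φ t y₀} :=
    hR.of_isClosed_subset (isClosed_clusterSet _ _) hLR
  have hLconn := isConnected_clusterSet (h.continuous_trajectory hyU) (Or.inl atTop_basis) hR hev
  by_cases hinj : Function.Injective fun t => Φ t y₀
  swap
  · obtain ⟨T, hT, hper⟩ := h.exists_periodic_of_not_injective hyU hinj
    have hL := h.omegaSet_eq_orbitOf hyU hT hper
    by_cases hf0 : f y₀ = 0
    · refine Or.inl ⟨hL ▸ ⟨_, 0, rfl⟩, ?_⟩
      rw [hL]
      rintro _ ⟨t, rfl⟩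
      change Φ t y₀ ∈ _
      rw [h.eq_self_of_eq_zero hyU hf0 t]
      exact ⟨hyU, hf0⟩
    · exact Or.inr (Or.inl ⟨y₀, hyU, hf0, ⟨T, hT, hper⟩, hL⟩)
  have hωeq : omegaSet Φ y₀ = {x | MapClusterPt x atTop fun t => Φ t y₀} :=
    omegaLimit_singleton_eq _ _ _
  rw [hωeq]
  by_cases hsub : {x | MapClusterPt x atTop fun t => Φ t y₀} ⊆ equilibria U f
  · exact Or.inl ⟨hLconn.nonempty, hsub⟩
  by_cases hperL : IsPeriodicOrbit U f Φ {x | MapClusterPt x atTop fun t => Φ t y₀}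
  · exact Or.inr (Or.inl hperL)
  have hev' : ∀ y, MapClusterPt y atTop (fun t => Φ t y₀) → ∀ t,
      Φ t y ∈ {x | MapClusterPt x atTop fun t => Φ t y₀} := fun y hy t =>
    h.mapClusterPt_map hU hf (hRU (hLR hy)) hyU hy t
  -- A non-equilibrium limit point of `y` would make the whole limit set a periodic orbit, which is
  -- excluded here.
  have hlim : ∀ y, MapClusterPt y atTop (fun t => Φ t y₀) → f y ≠ 0 → ∀ F : Filter ℝ,
      Tendsto abs F atTop → omegaLimit F Φ {y} ⊆ equilibria U f := by
    intro y hy hfy F hF z hz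
    rw [omegaLimit_singleton_eq] at hz
    refine ⟨hRU (hLR (clusterSet_subset hLc.isClosed (Eventually.of_forall (hev' y hy)) hz)), ?_⟩
    by_contra hfz
    exact hperL (h.isPeriodicOrbit_of_mapClusterPt hU hf hyU hinj (hLR.trans hRU) hLconn hy hfy hF
      hz hfz)
  have hconn : ∀ y, MapClusterPt y atTop (fun t => Φ t y₀) → f y ≠ 0 →
      OnGeneralizedConnectingOrbit U f Φ y := by
    intro y hy hfy
    have hyU' := hRU (hLR hy)
    have hall := fun F : Filter ℝ => Eventually.of_forall (f := F) (hev' y hy)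
    refine ⟨hfy, ⟨hlim y hy hfy _ tendsto_abs_atBot_atTop, ?_, ?_⟩,
      ⟨hlim y hy hfy _ tendsto_abs_atTop_atTop, ?_, ?_⟩⟩
    · rw [alphaSet, omegaLimit_singleton_eq]
      exact hLc.of_isClosed_subset (isClosed_clusterSet _ _)
        (clusterSet_subset hLc.isClosed (hall _))
    · rw [alphaSet, omegaLimit_singleton_eq]
      exact isConnected_clusterSet (h.continuous_trajectory hyU') (Or.inr atBot_basis) hLc (hall _)
    · rw [omegaSet, omegaLimit_singleton_eq]
      exact hLc.of_isClosed_subset (isClosed_clusterSet _ _)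
        (clusterSet_subset hLc.isClosed (hall _))
    · rw [omegaSet, omegaLimit_singleton_eq]
      exact isConnected_clusterSet (h.continuous_trajectory hyU') (Or.inl atTop_basis) hLc (hall _)
  obtain ⟨y, hy, hyeq⟩ := Set.not_subset.1 hsub
  have hfy : f y ≠ 0 := fun h0 => hyeq ⟨hRU (hLR hy), h0⟩
  refine Or.inr (Or.inr ⟨?_, ⟨y, hy, hconn y hy hfy⟩, fun x hx => ?_⟩)
  · obtain ⟨-, -, hω, -, ⟨e, he⟩, -⟩ := hconn y hy hfy
    refine ⟨e, ?_, hω he⟩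
    rw [omegaSet, omegaLimit_singleton_eq] at he
    exact clusterSet_subset hLc.isClosed (Eventually.of_forall (hev' y hy)) he
  · by_cases hfx : f x = 0
    · exact Or.inl ⟨hRU (hLR hx), hfx⟩
    · exact Or.inr (hconn x hx hfx)

/-- Both limit sets of `y` are connected sets of equilibria inside `omegaSet Φ y₀`, hence single
points; in a compact set a unique cluster point is a limit. -/
lemma IsUniqueSolutionMap.onConnectingOrbit (h : IsUniqueSolutionMap U f Φ) (hU : IsOpen U)
    (hf : ContinuousOn f U) {R : Set (EuclideanSpace ℝ (Fin 2))} (hRU : R ⊆ U) (hR : IsCompact R)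
    (hinv : IsForwardInvariant Φ R) {y₀ : EuclideanSpace ℝ (Fin 2)} (hy₀ : y₀ ∈ R)
    (htd : IsTotallyDisconnected (omegaSet Φ y₀ ∩ equilibria U f))
    {y : EuclideanSpace ℝ (Fin 2)} (hy : y ∈ omegaSet Φ y₀)
    (hgen : OnGeneralizedConnectingOrbit U f Φ y) : OnConnectingOrbit U f Φ y := by
  obtain ⟨hfy, ⟨hα, -, hαc⟩, hω, -, hωc⟩ := hgen
  have hyU := hRU hy₀
  have hLR : omegaSet Φ y₀ ⊆ R := by
    rw [omegaSet, omegaLimit_singleton_eq]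
    refine clusterSet_subset hR.isClosed ?_
    filter_upwards [eventually_ge_atTop 0] with t ht using hinv ht hy₀
  have hLc : IsCompact (omegaSet Φ y₀) := hR.of_isClosed_subset (isClosed_omegaLimit _ _ _) hLR
  have hstay : ∀ t, Φ t y ∈ omegaSet Φ y₀ := by
    rw [omegaSet, omegaLimit_singleton_eq] at hy ⊢
    exact h.mapClusterPt_map hU hf (hRU (hLR (by rwa [omegaSet, omegaLimit_singleton_eq]))) hyU hy
  have key : ∀ F : Filter ℝ, omegaLimit F Φ {y} ⊆ equilibria U f →
      IsConnected (omegaLimit F Φ {y}) → ∃ a ∈ equilibria U f, Tendsto (fun t => Φ t y) F (𝓝 a) := by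
    intro F hsub hconn
    have hsubL : omegaLimit F Φ {y} ⊆ omegaSet Φ y₀ := by
      rw [omegaLimit_singleton_eq]
      exact clusterSet_subset hLc.isClosed (Eventually.of_forall hstay)
    obtain ⟨a, ha⟩ := hconn.nonempty
    have hsing := htd _ (Set.subset_inter hsubL hsub) hconn.isPreconnected
    have heq := hsing.eq_singleton_of_mem ha
    rw [omegaLimit_singleton_eq] at heq
    exact ⟨a, hsub ha, tendsto_of_clusterSet_eq_singleton hLc (Eventually.of_forall hstay) heq⟩
  obtain ⟨a, ha, hta⟩ := key atBot hα hαc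
  obtain ⟨b, hb, htb⟩ := key atTop hω hωc
  exact ⟨hfy, a, ha, b, hb, hta, htb⟩

end PoincareBendixson

theorem theorem2
    (U : Set (EuclideanSpace ℝ (Fin 2))) (hU : IsOpen U)
    (f : EuclideanSpace ℝ (Fin 2) → EuclideanSpace ℝ (Fin 2)) (hf : ContinuousOn f U)
    (Φ : ℝ → EuclideanSpace ℝ (Fin 2) → EuclideanSpace ℝ (Fin 2))
    (hΦ : IsUniqueSolutionMap U f Φ)
    (R : Set (EuclideanSpace ℝ (Fin 2))) (hRU : R ⊆ U) (hR : IsCompact R)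
    (hinv : IsForwardInvariant Φ R)
    (y₀ : EuclideanSpace ℝ (Fin 2)) (hy₀ : y₀ ∈ R) :
    -- arbitrary equilibrium sets
    (((omegaSet Φ y₀).Nonempty ∧ omegaSet Φ y₀ ⊆ equilibria U f) ∨
      IsPeriodicOrbit U f Φ (omegaSet Φ y₀) ∨
      ((∃ e ∈ omegaSet Φ y₀, e ∈ equilibria U f) ∧
        (∃ y ∈ omegaSet Φ y₀, OnGeneralizedConnectingOrbit U f Φ y) ∧
        ∀ y ∈ omegaSet Φ y₀, y ∈ equilibria U f ∨ OnGeneralizedConnectingOrbit U f Φ y)) ∧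
    -- no continuum of equilibria in the limit set, for example finitely many equilibria
    (IsTotallyDisconnected (omegaSet Φ y₀ ∩ equilibria U f) →
      (∃ e ∈ equilibria U f, omegaSet Φ y₀ = {e}) ∨
      IsPeriodicOrbit U f Φ (omegaSet Φ y₀) ∨
      ((∃ e ∈ omegaSet Φ y₀, e ∈ equilibria U f) ∧
        (∃ y ∈ omegaSet Φ y₀, OnConnectingOrbit U f Φ y) ∧
        ∀ y ∈ omegaSet Φ y₀, y ∈ equilibria U f ∨ OnConnectingOrbit U f Φ y)) := by
  have hA := hΦ.trichotomy hU hf hRU hR hinv hy₀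
  refine ⟨hA, fun htd => ?_⟩
  rcases hA with ⟨hne, hsub⟩ | hper | ⟨he, ⟨y, hy, hgen⟩, hall⟩
  · left
    obtain ⟨e, he⟩ := hne
    have hconn : IsPreconnected (omegaSet Φ y₀) := by
      rw [omegaSet, omegaLimit_singleton_eq]
      refine (isConnected_clusterSet (hΦ.continuous_trajectory (hRU hy₀)) (Or.inl atTop_basis) hR
        ?_).isPreconnected
      filter_upwards [eventually_ge_atTop 0] with t ht using hinv ht hy₀
    exact ⟨e, hsub he,
      (htd _ (Set.subset_inter subset_rfl hsub) hconn).eq_singleton_of_mem he⟩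
  · exact Or.inr (Or.inl hper)
  · have hcon := fun {y} => hΦ.onConnectingOrbit (y := y) hU hf hRU hR hinv hy₀ htd
    exact Or.inr (Or.inr ⟨he, ⟨y, hy, hcon hy hgen⟩, fun x hx => (hall x hx).imp_right (hcon hx)⟩)
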